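/- Let $N\ge 1$, $0<\alpha<2$ and $\lambda\in\mathbb C\setminus\{0\}$. For $s\ge 0$ and $1<p<\infty$ let $H^{s,p}(\mathbb R^N)$ be the space of tempered distributions $v$ with $\mathcal F^{-1}\big[(1+|\xi|^2)^{s/2}\,\mathcal F v\big]\in L^p(\mathbb R^N)$, and let $C_0(\mathbb R^N)$ be the space of continuous functions $\mathbb R^N\to\mathbb C$ vanishing at infinity, with the sup norm. Then there exists a complex-valued initial value $\varphi\in C_c^\infty(\mathbb R^N)$ with the following property. The Cauchy problem $$u_t=\Delta u+\lambda|u|^\alpha u,\qquad u(0,\cdot)=\varphi,$$ has a (unique) maximal solution $u\in C([0,T_{\max}),C_0(\mathbb R^N))$, $0<T_{\max}\le\infty$, that is, a solution in the sense of Duhamel's formula $$u(t)=e^{t\Delta}\varphi+\lambda\int_0^t e^{(t-s)\Delta}\,|u(s)|^\alpha u(s)\,ds,\qquad 0\le t<T_{\max},$$ which extends every other solution in $C([0,T'),C_0(\mathbb R^N))$; and there is $\delta\in(0,T_{\max}]$, $\delta<\infty$, such that for every $0<t<\delta$, $$u(t)\notin H^{s,p}(\mathbb R^N)\qquad\text{for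 all } 1<p<\infty \text{ and all } s>5+\tfrac1p .$$ -/

import Mathlib

open MeasureTheory
open scoped ZeroAtInfty ContDiff SchwartzMap ENNReal

noncomputable section

namespace SemilinearHeat

/-- The Gauss–Weierstrass kernel `(4πt)^(-N/2) exp(-|x|²/(4t))` on `ℝ^N`. -/
def heatKernel {N : ℕ} (t : ℝ) (x : EuclideanSpace ℝ (Fin N)) : ℝ :=
  (4 * Real.pi * t) ^ (-((N : ℝ) / 2)) * Real.exp (-(‖x‖ ^ 2) / (4 * t))

/-- The heat semigroup `e^{tΔ} f`: convolution with the heat kernel for `t > 0`, and the identity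
for `t = 0` (only `t ≥ 0` is used). -/
def heatSemigroup {N : ℕ} (t : ℝ) (f : EuclideanSpace ℝ (Fin N) → ℂ)
    (x : EuclideanSpace ℝ (Fin N)) : ℂ :=
  if 0 < t then ∫ y, heatKernel t (x - y) • f y else f x

/-- The nonlinearity `z ↦ |z|^α z`. -/
def powerNonlinearity (α : ℝ) (z : ℂ) : ℂ := ((‖z‖ ^ α : ℝ) : ℂ) * z

/-- `u ∈ C([0,T), C₀(ℝ^N))` is a (mild) solution of `u_t = Δu + lam |u|^α u`, `u(0) = φ`, i.e. it
satisfies Duhamel's formula on `[0,T)`. Here `T ≤ ∞`; values of `u` outside `[0,T)` are irrelevant.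
At `t = 0` the formula reads `u(0) = φ`. -/
structure IsSolution {N : ℕ} (α : ℝ) (lam : ℂ) (φ : EuclideanSpace ℝ (Fin N) → ℂ)
    (T : EReal) (u : ℝ → C₀(EuclideanSpace ℝ (Fin N), ℂ)) : Prop where
  continuousOn : ContinuousOn u {t : ℝ | 0 ≤ t ∧ (t : EReal) < T}
  duhamel : ∀ t : ℝ, 0 ≤ t → (t : EReal) < T → ∀ x : EuclideanSpace ℝ (Fin N),
    u t x = heatSemigroup t φ x +
      lam * ∫ s in (0 : ℝ)..t, heatSemigroup (t - s) (fun y => powerNonlinearity α (u s y)) x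

/-- `u` on `[0,T)` is the maximal solution with initial value `φ`: `T > 0`, it is a solution on
`[0,T)`, and it extends every solution on an interval `[0,T')`. -/
structure IsMaximalSolution {N : ℕ} (α : ℝ) (lam : ℂ) (φ : EuclideanSpace ℝ (Fin N) → ℂ)
    (T : EReal) (u : ℝ → C₀(EuclideanSpace ℝ (Fin N), ℂ)) : Prop where
  pos : 0 < T
  isSolution : IsSolution α lam φ T u
  extends_all : ∀ (T' : EReal) (v : ℝ → C₀(EuclideanSpace ℝ (Fin N), ℂ)),
    IsSolution α lam φ T' v →
      T' ≤ T ∧ ∀ t : ℝ, 0 ≤ t → (t : EReal) < T' → v t = u t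

/-- The maximal solution, if it exists, is unique. -/
theorem IsMaximalSolution.unique {N : ℕ} {α : ℝ} {lam : ℂ}
    {φ : EuclideanSpace ℝ (Fin N) → ℂ} {T T' : EReal}
    {u v : ℝ → C₀(EuclideanSpace ℝ (Fin N), ℂ)}
    (hu : IsMaximalSolution α lam φ T u) (hv : IsMaximalSolution α lam φ T' v) :
    T = T' ∧ ∀ t : ℝ, 0 ≤ t → (t : EReal) < T → u t = v t :=
  ⟨le_antisymm (hv.extends_all T u hu.isSolution).1 (hu.extends_all T' v hv.isSolution).1,
    (hv.extends_all T u hu.isSolution).2⟩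

theorem memLp_top {N : ℕ} (f : C₀(EuclideanSpace ℝ (Fin N), ℂ)) :
    MemLp (fun x => f x) ∞ (volume : Measure (EuclideanSpace ℝ (Fin N))) :=
  memLp_top_of_bound f.continuous.aestronglyMeasurable ‖f‖
    (Filter.Eventually.of_forall fun x => f.toBCF.norm_coe_le_norm x)

/-- The tempered distribution `g ↦ ∫ g f` given by a function `f ∈ C₀(ℝ^N)`. -/
def toDistribution {N : ℕ} (f : C₀(EuclideanSpace ℝ (Fin N), ℂ)) :
    𝓢'(EuclideanSpace ℝ (Fin N), ℂ) :=
  Lp.toTemperedDistribution ((memLp_top f).toLp (fun x => f x))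

theorem toDistribution_apply {N : ℕ} (f : C₀(EuclideanSpace ℝ (Fin N), ℂ))
    (g : 𝓢(EuclideanSpace ℝ (Fin N), ℂ)) : toDistribution f g = ∫ x, g x * f x := by
  rw [toDistribution, Lp.toTemperedDistribution_apply]
  refine integral_congr_ae ?_
  filter_upwards [(memLp_top f).coeFn_toLp] with x hx
  rw [hx, smul_eq_mul]

/-- `f ∈ H^{s,p}(ℝ^N)`, the Bessel potential space: the tempered distribution
`𝓕⁻¹[(1+|ξ|²)^{s/2} 𝓕 f]` belongs to `L^p`. -/
def MemHsp {N : ℕ} (s : ℝ) (p : ℝ≥0∞) [Fact (1 ≤ p)]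
    (f : C₀(EuclideanSpace ℝ (Fin N), ℂ)) : Prop :=
  TemperedDistribution.MemSobolev s p (toDistribution f)

end SemilinearHeat

end

/-!
The initial value `φ` is odd in one coordinate `x i` and equals `x i` near the origin. Oddness is
preserved by the flow and gives `‖u t x - φ x‖ ≤ η |x i|` for small `t`, so that near the hyperplane
`x i = 0` the nonlinearity `|u|^α u` behaves like `|x i|^α x i`, whose smoothness is limited.

Pair `u t` with the fifth derivative in the direction `i` of products of one-dimensional heat
kernels, taken at time `a` in that direction and at times of order one in the others. The pairing
with `|x i|^α x i` is of order `a ^ (α / 2 - 2)`. In Duhamel's formula the heat semigroup moves onto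
the test function and replaces `a` by `a + (t - s)`, and integrating over `s` leaves
`a ^ (α / 2 - 1)`, which tends to infinity as `a → 0`. If `u t` were in `H^{s,p}` with
`s > 5 + 1/p`, these pairings would stay bounded: they are pairings of an `L^p` function with Bessel
potentials of the test functions, and a Bessel potential is a Gamma average of heat kernels.
-/

noncomputable section

namespace SemilinearHeat

open Filter Topology FourierTransform LineDeriv Set

variable {N : ℕ}

local notation "𝔼" => EuclideanSpace ℝ (Fin N)

/-! ### Products of one-dimensional heat kernels -/

theorem one_add_pow_mul_exp_neg_sq_le (j : ℕ) {c : ℝ} (hc : 0 < c) {r : ℝ} (hr : 0 ≤ r) :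
    (1 + r) ^ j * Real.exp (-(c * r ^ 2)) ≤ j.factorial / c ^ j * Real.exp (5 / 4 * c) := by
  have h_exp : (1 + r) ^ j ≤ j.factorial / c ^ j * Real.exp (c * (1 + r)) := by
    have h := Real.pow_div_factorial_le_exp (x := c * (1 + r)) (by positivity) j
    rw [div_le_iff₀ (by positivity), mul_pow] at h
    rw [div_mul_eq_mul_div, le_div_iff₀ (by positivity)]
    linarith
  calc (1 + r) ^ j * Real.exp (-(c * r ^ 2))
      ≤ j.factorial / c ^ j * Real.exp (c * (1 + r)) * Real.exp (-(c * r ^ 2)) := by gcongr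
    _ = j.factorial / c ^ j * Real.exp (c * (1 + r) + -(c * r ^ 2)) := by
        rw [Real.exp_add]; ring
    _ ≤ j.factorial / c ^ j * Real.exp (5 / 4 * c) := by
        gcongr
        nlinarith [mul_nonneg hc.le (sq_nonneg (r - 1 / 2))]

section ExpNeg

variable {E : Type*} [NormedAddCommGroup E] [NormedSpace ℝ E] {f : E → ℝ}

theorem exists_norm_iteratedFDeriv_exp_neg_le (hf : f.HasTemperateGrowth) (n : ℕ) :
    ∃ (m : ℕ) (C : ℝ), 0 ≤ C ∧ ∀ x, ‖iteratedFDeriv ℝ n (fun x => Real.exp (-f x)) x‖ ≤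
      C * (1 + ‖x‖) ^ m * Real.exp (-f x) := by
  obtain ⟨m, C, hC, hD⟩ := hf.neg.norm_iteratedFDeriv_le_uniform n
  refine ⟨m * n, n.factorial * (1 + C) ^ n, by positivity, fun x => ?_⟩
  have h_comp : ‖iteratedFDeriv ℝ n (fun x => Real.exp (-f x)) x‖ ≤
      n.factorial * Real.exp (-f x) * ((1 + C) * (1 + ‖x‖) ^ m) ^ n := by
    refine norm_iteratedFDeriv_comp_le (N := ∞) Real.contDiff_exp hf.1.neg
      (by exact_mod_cast le_top) x (fun i _ => ?_) fun i hi hin => ?_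
    · rw [norm_iteratedFDeriv_eq_norm_iteratedDeriv, iteratedDeriv_eq_iterate,
        Real.iter_deriv_exp, Real.norm_eq_abs, Real.abs_exp]
    · have h_one : (1 : ℝ) ≤ (1 + C) * (1 + ‖x‖) ^ m :=
        one_le_mul_of_one_le_of_one_le (by linarith)
          (one_le_pow₀ (by linarith [norm_nonneg x]))
      calc _ ≤ C * (1 + ‖x‖) ^ m := hD i hin x
        _ ≤ (1 + C) * (1 + ‖x‖) ^ m := by gcongr; linarith
        _ ≤ _ := le_self_pow₀ h_one (by omega)
  refine h_comp.trans_eq ?_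
  rw [mul_pow, ← pow_mul]
  ring

/-- `exp (-f)` as a Schwartz function, for `f` of temperate growth bounded below by a positive
multiple of `‖x‖ ^ 2`. -/
def expNegSchwartz (hf : f.HasTemperateGrowth) {c : ℝ} (hc : 0 < c)
    (hfc : ∀ x, c * ‖x‖ ^ 2 ≤ f x) : 𝓢(E, ℝ) where
  toFun x := Real.exp (-f x)
  smooth' := Real.contDiff_exp.comp hf.1.neg
  decay' k n := by
    obtain ⟨m, C, hC, hD⟩ := exists_norm_iteratedFDeriv_exp_neg_le hf n
    refine ⟨C * ((k + m).factorial / c ^ (k + m) * Real.exp (5 / 4 * c)), fun x => ?_⟩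
    calc ‖x‖ ^ k * ‖iteratedFDeriv ℝ n (fun x => Real.exp (-f x)) x‖
        ≤ (1 + ‖x‖) ^ k * (C * (1 + ‖x‖) ^ m * Real.exp (-(c * ‖x‖ ^ 2))) := by
          gcongr
          · linarith
          · refine (hD x).trans ?_
            gcongr
            exact hfc x
      _ = C * ((1 + ‖x‖) ^ (k + m) * Real.exp (-(c * ‖x‖ ^ 2))) := by rw [pow_add]; ring
      _ ≤ _ := mul_le_mul_of_nonneg_left
          (one_add_pow_mul_exp_neg_sq_le _ hc (norm_nonneg x)) hC

end ExpNeg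

/-- The one-dimensional heat kernel at time `a`. -/
def gauss (a y : ℝ) : ℝ := (√(4 * Real.pi * a))⁻¹ * Real.exp (-(y ^ 2 / (4 * a)))

theorem gauss_nonneg (a y : ℝ) : 0 ≤ gauss a y := by unfold gauss; positivity

@[fun_prop]
theorem continuous_gauss (a : ℝ) : Continuous (gauss a) := by unfold gauss; fun_prop

theorem gauss_neg (a y : ℝ) : gauss a (-y) = gauss a y := by simp [gauss]

theorem gauss_le {a : ℝ} (ha : 0 < a) (y : ℝ) : gauss a y ≤ (√a)⁻¹ := by
  calc gauss a y ≤ (√a)⁻¹ * 1 := by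
        unfold gauss
        gcongr
        · nlinarith [Real.pi_gt_three]
        · exact Real.exp_le_one_iff.2 (by simp only [Left.neg_nonpos_iff]; positivity)
    _ = (√a)⁻¹ := mul_one _

theorem gauss_sq_mul {r : ℝ} (hr : 0 < r) (a z : ℝ) :
    gauss (r ^ 2 * a) (r * z) = r⁻¹ * gauss a z := by
  have h_exponent : (r * z) ^ 2 / (4 * (r ^ 2 * a)) = z ^ 2 / (4 * a) := by
    rw [mul_pow, mul_left_comm, mul_div_mul_left _ _ (by positivity)]
  rw [gauss, gauss, h_exponent, mul_left_comm, Real.sqrt_mul (by positivity), Real.sqrt_sq hr.le,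
    mul_inv, mul_assoc]

theorem integrable_gauss {a : ℝ} (ha : 0 < a) : Integrable (gauss a) := by
  unfold gauss
  refine Integrable.const_mul ?_ _
  convert integrable_exp_neg_mul_sq (b := 1 / (4 * a)) (by positivity) using 3
  ring

theorem integral_gauss {a : ℝ} (ha : 0 < a) : ∫ y, gauss a y = 1 := by
  have h_exponent : ∀ y : ℝ, -(y ^ 2 / (4 * a)) = -(1 / (4 * a)) * y ^ 2 := fun y => by ring
  simp_rw [gauss, h_exponent, integral_const_mul, integral_gaussian,
    show Real.pi / (1 / (4 * a)) = 4 * Real.pi * a by field_simp]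
  exact inv_mul_cancel₀ (by positivity)

theorem hasDerivAt_gauss {a : ℝ} (ha : 0 < a) (y : ℝ) :
    HasDerivAt (gauss a) (-(y / (2 * a)) * gauss a y) y := by
  have h := (((hasDerivAt_pow 2 y).div_const (4 * a)).fun_neg.exp.const_mul
    (√(4 * Real.pi * a))⁻¹)
  refine h.congr_deriv ?_
  unfold gauss
  push_cast
  field_simp
  ring

theorem fourier_gauss {a : ℝ} (ha : 0 < a) (ξ : ℝ) :
    𝓕 (fun y : ℝ => (gauss a y : ℂ)) ξ =
      ((Real.exp (-(4 * Real.pi ^ 2 * (a * ξ ^ 2))) : ℝ) : ℂ) := by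
  have hb : 0 < ((4 * Real.pi * a : ℝ) : ℂ)⁻¹.re := by
    rw [← Complex.ofReal_inv, Complex.ofReal_re]
    positivity
  have hsqrt : (1 / (((4 * Real.pi * a : ℝ) : ℂ)⁻¹ ^ (1 / 2 : ℂ))) = (√(4 * Real.pi * a) : ℂ) := by
    rw [Real.sqrt_eq_rpow, Complex.ofReal_cpow (by positivity), ← Complex.ofReal_inv,
      Complex.ofReal_inv, Complex.inv_cpow _ _ (by
        rw [Complex.arg_ofReal_of_nonneg (by positivity)]; exact Real.pi_ne_zero.symm)]
    simp
  have hsqrt_ne : (√(4 * Real.pi * a) : ℂ) ≠ 0 := by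
    exact_mod_cast (by positivity : √(4 * Real.pi * a) ≠ 0)
  calc 𝓕 (fun y : ℝ => (gauss a y : ℂ)) ξ
      = (√(4 * Real.pi * a) : ℂ)⁻¹ * 𝓕 (fun y : ℝ =>
          Complex.exp (-Real.pi * ((4 * Real.pi * a : ℝ) : ℂ)⁻¹ * y ^ 2)) ξ := by
        rw [Real.fourier_eq', Real.fourier_eq', ← integral_const_mul]
        congr with y
        simp only [gauss, smul_eq_mul, Complex.ofReal_mul, Complex.ofReal_inv, Complex.ofReal_exp]
        rw [mul_left_comm]
        congr 3
        push_cast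
        field_simp
    _ = Complex.exp (-Real.pi / ((4 * Real.pi * a : ℝ) : ℂ)⁻¹ * ξ ^ 2) := by
        rw [fourier_gaussian_pi hb, hsqrt, inv_mul_cancel_left₀ hsqrt_ne]
    _ = _ := by
        push_cast
        congr 1
        rw [div_inv_eq_mul]
        ring

/-- The product of the one-dimensional heat kernels at the times `c i`, the heat kernel with a
separate time for each coordinate direction. -/
def gaussProd (c : Fin N → ℝ) (x : 𝔼) : ℝ := ∏ i, gauss (c i) (x i)

theorem gaussProd_nonneg (c : Fin N → ℝ) (x : 𝔼) : 0 ≤ gaussProd c x :=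
  Finset.prod_nonneg fun _ _ => gauss_nonneg _ _

theorem gaussProd_neg (c : Fin N → ℝ) (x : 𝔼) : gaussProd c (-x) = gaussProd c x := by
  simp [gaussProd, gauss_neg]

@[fun_prop]
theorem continuous_gaussProd (c : Fin N → ℝ) : Continuous (gaussProd c) := by
  unfold gaussProd; fun_prop

theorem gaussProd_eq (c : Fin N → ℝ) (x : 𝔼) :
    gaussProd c x = (∏ i, (√(4 * Real.pi * c i))⁻¹) * Real.exp (-∑ i, x i ^ 2 / (4 * c i)) := by
  simp [gaussProd, gauss, Finset.prod_mul_distrib, ← Real.exp_sum]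

theorem heatKernel_eq_gaussProd {t : ℝ} (ht : 0 < t) (x : 𝔼) :
    heatKernel t x = gaussProd (fun _ => t) x := by
  rw [gaussProd_eq, heatKernel, EuclideanSpace.real_norm_sq_eq, ← Finset.sum_div, neg_div]
  congr 1
  rw [Finset.prod_const, Finset.card_univ, Fintype.card_fin, Real.sqrt_eq_rpow,
    ← Real.rpow_neg (by positivity), ← Real.rpow_natCast, ← Real.rpow_mul (by positivity)]
  congr 1
  ring

theorem hasTemperateGrowth_sum_sq_div (c : Fin N → ℝ) :
    (fun x : 𝔼 => ∑ i, x i ^ 2 / (4 * c i)).HasTemperateGrowth := by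
  refine Function.HasTemperateGrowth.sum fun i _ => ?_
  have h_coord : (fun x : 𝔼 => x i).HasTemperateGrowth :=
    (EuclideanSpace.proj (𝕜 := ℝ) i : 𝔼 →L[ℝ] ℝ).hasTemperateGrowth
  exact (h_coord.pow 2).mul (Function.HasTemperateGrowth.const ((4 * c i)⁻¹))

theorem exists_mul_norm_sq_le_sum_sq_div {c : Fin N → ℝ} (hc : ∀ i, 0 < c i) :
    ∃ b : ℝ, 0 < b ∧ ∀ x : 𝔼, b * ‖x‖ ^ 2 ≤ ∑ i, x i ^ 2 / (4 * c i) := by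
  have hsum : 0 ≤ ∑ i, c i := Finset.sum_nonneg fun i _ => (hc i).le
  refine ⟨(4 * (1 + ∑ i, c i))⁻¹, by positivity, fun x => ?_⟩
  rw [EuclideanSpace.real_norm_sq_eq, Finset.mul_sum]
  refine Finset.sum_le_sum fun i hi => ?_
  have hle : c i ≤ ∑ j, c j := Finset.single_le_sum (fun j _ => (hc j).le) hi
  have hci := hc i
  rw [div_eq_inv_mul]
  gcongr
  linarith

/-- `gaussProd c` as a complex-valued Schwartz function. -/
def gaussSchwartz (c : Fin N → ℝ) (hc : ∀ i, 0 < c i) : 𝓢(𝔼, ℂ) :=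
  SchwartzMap.postcompCLM (𝕜 := ℝ) Complex.ofRealCLM
    ((∏ i, (√(4 * Real.pi * c i))⁻¹) • expNegSchwartz (hasTemperateGrowth_sum_sq_div c)
      (exists_mul_norm_sq_le_sum_sq_div hc).choose_spec.1
      (exists_mul_norm_sq_le_sum_sq_div hc).choose_spec.2)

theorem gaussSchwartz_apply (c : Fin N → ℝ) (hc : ∀ i, 0 < c i) (x : 𝔼) :
    gaussSchwartz c hc x = (gaussProd c x : ℂ) := by
  rw [gaussProd_eq]
  rfl

theorem integrable_gaussProd {c : Fin N → ℝ} (hc : ∀ i, 0 < c i) :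
    Integrable (gaussProd c : 𝔼 → ℝ) := by
  simpa [gaussSchwartz_apply] using ((gaussSchwartz c hc).integrable (μ := volume)).re

theorem integral_prod_coord {𝕜 : Type*} [RCLike 𝕜] (f : Fin N → ℝ → 𝕜) :
    ∫ x : 𝔼, ∏ i, f i (x i) = ∏ i, ∫ y, f i y := by
  rw [← integral_fintype_prod_volume_eq_prod,
    ← (PiLp.volume_preserving_toLp (Fin N)).integral_comp
    (MeasurableEquiv.toLp 2 _).measurableEmbedding]

theorem integral_mul_prod_erase {𝕜 : Type*} [RCLike 𝕜] (i : Fin N) (f : ℝ → 𝕜)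
    (g : Fin N → ℝ → 𝕜) : ∫ x : 𝔼, f (x i) * ∏ j ∈ Finset.univ.erase i, g j (x j) =
      (∫ y, f y) * ∏ j ∈ Finset.univ.erase i, ∫ y, g j y := by
  have h_update : ∀ A : (ℝ → 𝕜) → ℝ → 𝕜, ∀ y : Fin N → ℝ,
      A f (y i) * ∏ j ∈ Finset.univ.erase i, A (g j) (y j) =
        ∏ j, A (Function.update g i f j) (y j) := fun A y => by
    rw [← Finset.mul_prod_erase _ _ (Finset.mem_univ i), Function.update_self]
    congr 1
    exact Finset.prod_congr rfl fun j hj => by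
      rw [Function.update_of_ne (Finset.ne_of_mem_erase hj)]
  rw [h_update (fun h _ => ∫ y, h y) 0, ← integral_prod_coord]
  exact integral_congr_ae (.of_forall fun x => h_update id x)

theorem integral_gaussProd {c : Fin N → ℝ} (hc : ∀ i, 0 < c i) :
    ∫ x : 𝔼, gaussProd c x = 1 :=
  (integral_prod_coord fun i => gauss (c i)).trans
    (Finset.prod_eq_one fun i _ => integral_gauss (hc i))

theorem fourier_gaussSchwartz (c : Fin N → ℝ) (hc : ∀ i, 0 < c i) (ξ : 𝔼) :
    𝓕 (gaussSchwartz c hc) ξ =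
      ((Real.exp (-(4 * Real.pi ^ 2 * ∑ i, c i * ξ i ^ 2)) : ℝ) : ℂ) := by
  have h_factor : ∀ v : 𝔼, Complex.exp (((-2 * Real.pi * inner ℝ v ξ : ℝ) : ℂ) * Complex.I) •
      gaussSchwartz c hc v = ∏ i, Complex.exp (((-2 * Real.pi * inner ℝ (v i) (ξ i) : ℝ) : ℂ) *
        Complex.I) • (gauss (c i) (v i) : ℂ) := by
    intro v
    simp only [gaussSchwartz_apply, gaussProd, smul_eq_mul, Finset.prod_mul_distrib,
      ← Complex.exp_sum, PiLp.inner_apply]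
    push_cast
    rw [Finset.mul_sum, Finset.sum_mul]
  rw [SchwartzMap.fourier_coe, Real.fourier_eq', integral_congr_ae (.of_forall h_factor),
    integral_prod_coord fun i y =>
      Complex.exp (((-2 * Real.pi * inner ℝ y (ξ i) : ℝ) : ℂ) * Complex.I) • (gauss (c i) y : ℂ),
    Finset.mul_sum, ← Finset.sum_neg_distrib, Real.exp_sum, Complex.ofReal_prod]
  refine Finset.prod_congr rfl fun i _ => ?_
  rw [← fourier_gauss (hc i), Real.fourier_eq']

/-! ### Fifth derivatives of heat kernels -/

/-- The fifth derivative of the one-dimensional heat kernel `gauss a`. -/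
def fifthDerivGauss (a y : ℝ) : ℝ :=
  -(y ^ 5 / (2 * a) ^ 5 - 10 * y ^ 3 / (2 * a) ^ 4 + 15 * y / (2 * a) ^ 3) * gauss a y

/-- The test functions: the fifth derivative of `gaussProd c` in the direction `i`. -/
def testFun (i : Fin N) (c : Fin N → ℝ) (x : 𝔼) : ℝ :=
  fifthDerivGauss (c i) (x i) * ∏ j ∈ Finset.univ.erase i, gauss (c j) (x j)

/-- `testFun i c` as a Schwartz function. -/
def testSchwartz (i : Fin N) (c : Fin N → ℝ) (hc : ∀ i, 0 < c i) : 𝓢(𝔼, ℂ) :=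
  ∂^{fun _ : Fin 5 => (EuclideanSpace.single i (1 : ℝ) : 𝔼)} (gaussSchwartz c hc)

@[fun_prop]
theorem continuous_fifthDerivGauss (a : ℝ) : Continuous (fifthDerivGauss a) := by
  unfold fifthDerivGauss; fun_prop

theorem fifthDerivGauss_neg (a y : ℝ) : fifthDerivGauss a (-y) = -fifthDerivGauss a y := by
  rw [fifthDerivGauss, fifthDerivGauss, gauss_neg]
  ring

theorem fifthDerivGauss_sq {r : ℝ} (hr : 0 < r) (z : ℝ) :
    fifthDerivGauss (r ^ 2) (r * z) = (r ^ 6)⁻¹ * fifthDerivGauss 1 z := by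
  have h_gauss := gauss_sq_mul hr 1 z
  rw [mul_one] at h_gauss
  rw [fifthDerivGauss, fifthDerivGauss, h_gauss]
  field_simp

@[fun_prop]
theorem continuous_testFun (i : Fin N) (c : Fin N → ℝ) : Continuous (testFun i c) := by
  unfold testFun; fun_prop

theorem gaussProd_eq_mul (i : Fin N) (c : Fin N → ℝ) (x : 𝔼) :
    gaussProd c x = gauss (c i) (x i) * ∏ j ∈ Finset.univ.erase i, gauss (c j) (x j) := by
  rw [gaussProd, ← Finset.mul_prod_erase _ _ (Finset.mem_univ i)]

theorem gaussProd_add_smul_single (i : Fin N) (c : Fin N → ℝ) (x : 𝔼) (s : ℝ) :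
    gaussProd c (x + s • EuclideanSpace.single i (1 : ℝ)) =
      gauss (c i) (x i + s) * ∏ j ∈ Finset.univ.erase i, gauss (c j) (x j) := by
  rw [gaussProd_eq_mul i]
  congr 1
  · simp
  · refine Finset.prod_congr rfl fun j hj => ?_
    simp [Finset.ne_of_mem_erase hj]

open Polynomial in
/-- The operator on polynomials with `(P * gauss a)' = gaussDeriv a P * gauss a`. -/
def gaussDeriv (a : ℝ) (P : ℝ[X]) : ℝ[X] := derivative P - C (2 * a)⁻¹ * X * P

open Polynomial in
theorem lineDerivOp_eval_mul_gaussProd (i : Fin N) {c : Fin N → ℝ} (hc : 0 < c i)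
    {f : 𝓢(𝔼, ℂ)} {P : ℝ[X]} (hf : ∀ x : 𝔼, f x = ((P.eval (x i) * gaussProd c x : ℝ) : ℂ))
    (x : 𝔼) : ∂_{(EuclideanSpace.single i (1 : ℝ) : 𝔼)} f x =
      (((gaussDeriv (c i) P).eval (x i) * gaussProd c x : ℝ) : ℂ) := by
  rw [SchwartzMap.lineDerivOp_apply]
  refine HasLineDerivAt.lineDeriv ?_
  unfold HasLineDerivAt
  have h := (((P.hasDerivAt (x i + 0)).comp_const_add (x i) 0).mul
    (((hasDerivAt_gauss hc (x i + 0)).comp_const_add (x i) 0).mul_const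
    (∏ j ∈ Finset.univ.erase i, gauss (c j) (x j)))).ofReal_comp
  simp only [hf, gaussProd_add_smul_single, PiLp.add_apply, PiLp.smul_apply, PiLp.single_apply,
    if_true, smul_eq_mul, mul_one]
  refine h.congr_deriv ?_
  simp only [gaussProd_eq_mul i c x, gaussDeriv, eval_sub, eval_mul, eval_C, eval_X, add_zero]
  congr 1
  ring

theorem iteratedLineDerivOp_gaussSchwartz (i : Fin N) (c : Fin N → ℝ) (hc : ∀ i, 0 < c i) (n : ℕ)
    (x : 𝔼) : ∂^{fun _ : Fin n => (EuclideanSpace.single i (1 : ℝ) : 𝔼)} (gaussSchwartz c hc) x =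
      ((((gaussDeriv (c i))^[n] 1).eval (x i) * gaussProd c x : ℝ) : ℂ) := by
  induction n generalizing x with
  | zero =>
    rw [iteratedLineDerivOp_fin_zero, gaussSchwartz_apply, Function.iterate_zero_apply,
      Polynomial.eval_one, one_mul]
  | succ n ih =>
    rw [iteratedLineDerivOp_succ_left, Function.iterate_succ_apply']
    exact lineDerivOp_eval_mul_gaussProd i (hc i) ih x

open Polynomial in
theorem eval_iterate_gaussDeriv_five (a y : ℝ) : ((gaussDeriv a)^[5] 1).eval y =
    -(y ^ 5 / (2 * a) ^ 5 - 10 * y ^ 3 / (2 * a) ^ 4 + 15 * y / (2 * a) ^ 3) := by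
  simp only [Function.iterate_succ_apply, Function.iterate_zero_apply]
  simp only [gaussDeriv, derivative_sub, derivative_mul, derivative_C, derivative_X,
    derivative_one, eval_sub, eval_mul, eval_add, eval_C, eval_X, eval_one, eval_zero, map_zero,
    map_add]
  ring

theorem testSchwartz_apply (i : Fin N) (c : Fin N → ℝ) (hc : ∀ i, 0 < c i) (x : 𝔼) :
    testSchwartz i c hc x = (testFun i c x : ℂ) := by
  rw [testSchwartz, iteratedLineDerivOp_gaussSchwartz, eval_iterate_gaussDeriv_five, testFun,
    fifthDerivGauss, gaussProd_eq_mul i, mul_assoc]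

theorem integrable_testFun (i : Fin N) {c : Fin N → ℝ} (hc : ∀ j, 0 < c j) :
    Integrable (testFun i c : 𝔼 → ℝ) := by
  simpa [testSchwartz_apply] using ((testSchwartz i c hc).integrable (μ := volume)).re

theorem fourier_testSchwartz (i : Fin N) (c : Fin N → ℝ) (hc : ∀ i, 0 < c i) (ξ : 𝔼) :
    𝓕 (testSchwartz i c hc) ξ = (2 * Real.pi * Complex.I * ξ i) ^ 5 *
      ((Real.exp (-(4 * Real.pi ^ 2 * ∑ i, c i * ξ i ^ 2)) : ℝ) : ℂ) := by
  have h_lineDeriv : ∀ (f : 𝓢(𝔼, ℂ)) (ξ : 𝔼),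
      𝓕 (∂_{(EuclideanSpace.single i (1 : ℝ) : 𝔼)} f) ξ =
        (2 * Real.pi * Complex.I * ξ i) * 𝓕 f ξ := by
    intro f ξ
    rw [SchwartzMap.fourier_lineDerivOp_eq, smul_apply,
      SchwartzMap.smulLeftCLM_apply_apply (by fun_prop), EuclideanSpace.inner_single_right]
    simp [mul_assoc]
  simp only [testSchwartz, iteratedLineDerivOp_const_eq_iter_lineDerivOp,
    Function.iterate_succ_apply, Function.iterate_zero_apply, h_lineDeriv, fourier_gaussSchwartz]
  ring

theorem integral_gaussProd_mul_testFun (i : Fin N) {τ : ℝ} (hτ : 0 < τ) {c : Fin N → ℝ}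
    (hc : ∀ i, 0 < c i) (x : 𝔼) :
    ∫ y, gaussProd (fun _ => τ) (x - y) * testFun i c y = testFun i (fun j => c j + τ) x := by
  have hcτ : ∀ j, 0 < c j + τ := fun j => add_pos (hc j) hτ
  have h_conv : SchwartzMap.convolution (ContinuousLinearMap.mul ℂ ℂ) (testSchwartz i c hc)
      (gaussSchwartz (fun _ : Fin N => τ) fun _ => hτ) = testSchwartz i (fun j => c j + τ) hcτ := by
    apply (fourierEquiv ℂ 𝓢(𝔼, ℂ)).injective
    rw [fourierEquiv_apply, fourierEquiv_apply, SchwartzMap.fourier_convolution]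
    ext ξ
    rw [SchwartzMap.pairing_apply_apply, fourier_testSchwartz, fourier_testSchwartz,
      fourier_gaussSchwartz, ContinuousLinearMap.mul_apply', mul_assoc, ← Complex.ofReal_mul,
      ← Real.exp_add]
    simp only [add_mul, Finset.sum_add_distrib, mul_add, neg_add]
  have h_apply := congrArg (fun f : 𝓢(𝔼, ℂ) => f x) h_conv
  simp only [SchwartzMap.convolution_apply, convolution, ContinuousLinearMap.mul_apply',
    testSchwartz_apply, gaussSchwartz_apply] at h_apply
  rw [← Complex.ofReal_inj, ← h_apply, ← integral_complex_ofReal]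
  simp only [Complex.ofReal_mul, mul_comm]

theorem gauss_one_eq_gauss_two_mul (z : ℝ) :
    gauss 1 z = √2 * gauss 2 z * Real.exp (-(1 / 8 * |z| ^ 2)) := by
  have h_sqrt : √(4 * Real.pi * 2) = √2 * √(4 * Real.pi * 1) := by
    rw [← Real.sqrt_mul (by norm_num), mul_one, mul_comm]
  have h_exp : Real.exp (-(z ^ 2 / (4 * 1))) =
      Real.exp (-(z ^ 2 / (4 * 2))) * Real.exp (-(1 / 8 * |z| ^ 2)) := by
    rw [← Real.exp_add, sq_abs]
    ring_nf
  rw [gauss, gauss, h_sqrt, h_exp, mul_inv]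
  field_simp

theorem abs_fifthDerivGauss_one_le (z : ℝ) :
    |fifthDerivGauss 1 z| ≤ 2 * (1 + |z|) ^ 5 * gauss 1 z := by
  have h_triangle : |-(z ^ 5 / (2 * 1) ^ 5 - 10 * z ^ 3 / (2 * 1) ^ 4 + 15 * z / (2 * 1) ^ 3)| ≤
      |z| ^ 5 / 32 + 10 / 16 * |z| ^ 3 + 15 / 8 * |z| := by
    rw [abs_neg]
    refine (abs_add_le _ _).trans (add_le_add ((abs_sub _ _).trans (le_of_eq ?_)) (le_of_eq ?_))
    · simp only [abs_div, abs_mul, abs_pow]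
      norm_num
      ring
    · simp only [abs_div, abs_mul]
      norm_num
      ring
  rw [fifthDerivGauss, abs_mul, abs_of_nonneg (gauss_nonneg 1 z)]
  refine mul_le_mul_of_nonneg_right (h_triangle.trans ?_) (gauss_nonneg 1 z)
  have hz := abs_nonneg z
  nlinarith [pow_nonneg hz 2, pow_nonneg hz 3, pow_nonneg hz 4, pow_nonneg hz 5]

theorem exists_abs_rpow_mul_fifthDerivGauss_one_le {β : ℝ} (hβ : 0 ≤ β) :
    ∃ C : ℝ, 0 < C ∧ ∀ z : ℝ, |z| ^ β * |fifthDerivGauss 1 z| ≤ C * gauss 2 z := by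
  refine ⟨2 * √2 * ((⌈β⌉₊ + 5).factorial / (1 / 8) ^ (⌈β⌉₊ + 5) * Real.exp (5 / 4 * (1 / 8))),
    by positivity, fun z => ?_⟩
  have h_rpow : |z| ^ β ≤ (1 + |z|) ^ ⌈β⌉₊ := by
    calc |z| ^ β ≤ (1 + |z|) ^ β := by gcongr; linarith
      _ ≤ (1 + |z|) ^ ((⌈β⌉₊ : ℕ) : ℝ) :=
        Real.rpow_le_rpow_of_exponent_le (by linarith [abs_nonneg z]) (Nat.le_ceil β)
      _ = (1 + |z|) ^ ⌈β⌉₊ := Real.rpow_natCast _ _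
  have h_gauss := gauss_nonneg 2 z
  calc |z| ^ β * |fifthDerivGauss 1 z|
      ≤ (1 + |z|) ^ ⌈β⌉₊ * (2 * (1 + |z|) ^ 5 *
          (√2 * gauss 2 z * Real.exp (-(1 / 8 * |z| ^ 2)))) := by
        rw [← gauss_one_eq_gauss_two_mul]
        gcongr
        exact abs_fifthDerivGauss_one_le z
    _ = 2 * √2 * ((1 + |z|) ^ (⌈β⌉₊ + 5) * Real.exp (-(1 / 8 * |z| ^ 2))) * gauss 2 z := by ring
    _ ≤ _ := by
        gcongr ?_ * gauss 2 z
        exact mul_le_mul_of_nonneg_left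
          (one_add_pow_mul_exp_neg_sq_le _ (by norm_num) (abs_nonneg z)) (by positivity)

theorem exists_abs_rpow_mul_fifthDerivGauss_le {β : ℝ} (hβ : 0 ≤ β) : ∃ C : ℝ, 0 < C ∧
    ∀ a : ℝ, 0 < a → ∀ y : ℝ, |y| ^ β * |fifthDerivGauss a y| ≤
      C * a ^ (β / 2 - 5 / 2) * gauss (2 * a) y := by
  obtain ⟨C, hC, h_one⟩ := exists_abs_rpow_mul_fifthDerivGauss_one_le hβ
  refine ⟨C, hC, fun a ha y => ?_⟩
  obtain ⟨r, hr, rfl⟩ : ∃ r : ℝ, 0 < r ∧ a = r ^ 2 :=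
    ⟨√a, Real.sqrt_pos.2 ha, (Real.sq_sqrt ha.le).symm⟩
  obtain ⟨z, rfl⟩ : ∃ z : ℝ, y = r * z := ⟨y / r, by field_simp⟩
  have h_power : (r ^ 2) ^ (β / 2 - 5 / 2) * r⁻¹ = r ^ β * (r ^ 6)⁻¹ := by
    rw [← Real.rpow_natCast, ← Real.rpow_mul hr.le, ← Real.rpow_neg_one, ← Real.rpow_natCast,
      ← Real.rpow_neg hr.le, ← Real.rpow_add hr, ← Real.rpow_add hr]
    congr 1
    push_cast
    ring
  calc |r * z| ^ β * |fifthDerivGauss (r ^ 2) (r * z)|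
      = r ^ β * (r ^ 6)⁻¹ * (|z| ^ β * |fifthDerivGauss 1 z|) := by
        rw [fifthDerivGauss_sq hr, abs_mul r z, abs_mul (r ^ 6)⁻¹, abs_of_pos hr,
          abs_of_pos (show 0 < (r ^ 6)⁻¹ by positivity), Real.mul_rpow hr.le (abs_nonneg z)]
        ring
    _ ≤ r ^ β * (r ^ 6)⁻¹ * (C * gauss 2 z) :=
        mul_le_mul_of_nonneg_left (h_one z) (by positivity)
    _ = C * (r ^ 2) ^ (β / 2 - 5 / 2) * gauss (2 * r ^ 2) (r * z) := by
        rw [mul_comm 2, gauss_sq_mul hr, ← h_power]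
        ring

theorem gaussProd_update (i : Fin N) (c : Fin N → ℝ) (b : ℝ) (x : 𝔼) :
    gaussProd (Function.update c i b) x =
      gauss b (x i) * ∏ j ∈ Finset.univ.erase i, gauss (c j) (x j) := by
  rw [gaussProd_eq_mul i, Function.update_self]
  congr 1
  exact Finset.prod_congr rfl fun j hj => by
    rw [Function.update_of_ne (Finset.ne_of_mem_erase hj)]

theorem prod_erase_gauss_nonneg (i : Fin N) (c : Fin N → ℝ) (x : 𝔼) :
    0 ≤ ∏ j ∈ Finset.univ.erase i, gauss (c j) (x j) :=
  Finset.prod_nonneg fun _ _ => gauss_nonneg _ _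

theorem exists_abs_rpow_mul_testFun_le {β : ℝ} (hβ : 0 ≤ β) : ∃ C : ℝ, 0 < C ∧
    ∀ (i : Fin N) (c : Fin N → ℝ), 0 < c i → ∀ x : 𝔼, |x i| ^ β * |testFun i c x| ≤
      C * c i ^ (β / 2 - 5 / 2) * gaussProd (Function.update c i (2 * c i)) x := by
  obtain ⟨C, hC, h⟩ := exists_abs_rpow_mul_fifthDerivGauss_le hβ
  refine ⟨C, hC, fun i c hi x => ?_⟩
  rw [gaussProd_update, testFun, abs_mul, abs_of_nonneg (prod_erase_gauss_nonneg i c x),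
    ← mul_assoc, ← mul_assoc]
  exact mul_le_mul_of_nonneg_right (h (c i) hi (x i)) (prod_erase_gauss_nonneg i c x)

theorem gaussProd_update_le {i : Fin N} {c : Fin N → ℝ} (hi : 0 < c i)
    (hc : ∀ j, j ≠ i → 1 ≤ c j) (x : 𝔼) :
    gaussProd (Function.update c i (2 * c i)) x ≤ c i ^ (-(1 / 2) : ℝ) := by
  have h_erase : ∏ j ∈ Finset.univ.erase i, gauss (c j) (x j) ≤ 1 := by
    refine Finset.prod_le_one (fun _ _ => gauss_nonneg _ _) fun j hj => ?_
    have hj1 := hc j (Finset.ne_of_mem_erase hj)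
    exact (gauss_le (by linarith) _).trans (inv_le_one_of_one_le₀ (Real.one_le_sqrt.2 hj1))
  calc gaussProd (Function.update c i (2 * c i)) x
      ≤ (√(2 * c i))⁻¹ * 1 := by
        rw [gaussProd_update]
        exact mul_le_mul (gauss_le (by linarith) _) h_erase (prod_erase_gauss_nonneg i c x)
          (by positivity)
    _ ≤ (√(c i))⁻¹ := by
        rw [mul_one]
        gcongr
        linarith
    _ = c i ^ (-(1 / 2) : ℝ) := by rw [Real.rpow_neg hi.le, ← Real.sqrt_eq_rpow]

theorem exists_abs_testFun_le : ∃ C : ℝ, 0 < C ∧ ∀ (i : Fin N) (c : Fin N → ℝ), 0 < c i →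
    (∀ j, j ≠ i → 1 ≤ c j) → ∀ x : 𝔼, |testFun i c x| ≤ C * c i ^ (-3 : ℝ) := by
  obtain ⟨C, hC, h⟩ := exists_abs_rpow_mul_testFun_le (N := N) le_rfl
  refine ⟨C, hC, fun i c hi hc x => ?_⟩
  calc |testFun i c x|
      ≤ C * c i ^ ((0 : ℝ) / 2 - 5 / 2) * gaussProd (Function.update c i (2 * c i)) x := by
        simpa only [Real.rpow_zero, one_mul] using h i c hi x
    _ ≤ C * c i ^ ((0 : ℝ) / 2 - 5 / 2) * c i ^ (-(1 / 2) : ℝ) := by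
        gcongr
        exact gaussProd_update_le hi hc x
    _ = C * c i ^ (-3 : ℝ) := by rw [mul_assoc, ← Real.rpow_add hi]; norm_num

theorem update_two_mul_pos (i : Fin N) {c : Fin N → ℝ} (hc : ∀ j, 0 < c j) (j : Fin N) :
    0 < Function.update c i (2 * c i) j := by
  rcases eq_or_ne j i with rfl | h
  · simpa using hc j
  · simpa [h] using hc j

theorem integrable_abs_rpow_mul_testFun {β : ℝ} (hβ : 0 ≤ β) (i : Fin N) {c : Fin N → ℝ}
    (hc : ∀ j, 0 < c j) : Integrable (fun x : 𝔼 => |x i| ^ β * |testFun i c x|) := by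
  obtain ⟨C, -, h⟩ := exists_abs_rpow_mul_testFun_le (N := N) hβ
  refine ((integrable_gaussProd (update_two_mul_pos i hc)).const_mul
    (C * c i ^ (β / 2 - 5 / 2))).mono' ?_ (.of_forall fun x => ?_)
  · have h_rpow : Continuous fun x : 𝔼 => |x i| ^ β :=
      (by fun_prop : Continuous fun x : 𝔼 => |x i|).rpow_const fun _ => Or.inr hβ
    exact (h_rpow.mul (continuous_testFun i c).abs).aestronglyMeasurable
  · rw [Real.norm_of_nonneg (by positivity)]
    exact h i c (hc i) x

theorem exists_integral_abs_rpow_mul_testFun_le {β : ℝ} (hβ : 0 ≤ β) : ∃ C : ℝ, 0 < C ∧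
    ∀ (i : Fin N) (c : Fin N → ℝ), (∀ j, 0 < c j) →
      ∫ x : 𝔼, |x i| ^ β * |testFun i c x| ≤ C * c i ^ (β / 2 - 5 / 2) := by
  obtain ⟨C, hC, h⟩ := exists_abs_rpow_mul_testFun_le (N := N) hβ
  refine ⟨C, hC, fun i c hc => ?_⟩
  have h_pos := update_two_mul_pos i hc
  calc ∫ x : 𝔼, |x i| ^ β * |testFun i c x|
      ≤ ∫ x, C * c i ^ (β / 2 - 5 / 2) * gaussProd (Function.update c i (2 * c i)) x :=
        integral_mono (integrable_abs_rpow_mul_testFun hβ i hc)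
          ((integrable_gaussProd h_pos).const_mul _) fun x => h i c (hc i) x
    _ = C * c i ^ (β / 2 - 5 / 2) := by
        rw [integral_const_mul, integral_gaussProd h_pos, mul_one]

theorem lintegral_mul_le_rpow_of_le {X : Type*} [MeasurableSpace X] {μ : Measure X} {p : ℝ}
    (hp : 1 < p) {w K : X → ℝ≥0∞} (hw : AEMeasurable w μ) (hK : AEMeasurable K μ) {M : ℝ≥0∞}
    (hM : M ≠ ⊤) (hKM : ∀ x, K x ≤ M) (hK1 : ∫⁻ x, K x ∂μ ≤ 1) :
    ∫⁻ x, w x * K x ∂μ ≤ (∫⁻ x, w x ^ p ∂μ) ^ (1 / p) * M ^ (1 / p) := by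
  have hpq : p.HolderConjugate p.conjExponent := .conjExponent hp
  have hp0 := hpq.pos
  have hq0 := hpq.symm.pos
  calc ∫⁻ x, w x * K x ∂μ
      = ∫⁻ x, (w x * K x ^ (1 / p)) * K x ^ (1 / p.conjExponent) ∂μ := by
        refine lintegral_congr fun x => ?_
        rw [mul_assoc, ← ENNReal.rpow_add_of_nonneg _ _ (by positivity) (by positivity), one_div,
          one_div, hpq.inv_add_inv_eq_one, ENNReal.rpow_one]
    _ ≤ (∫⁻ x, (w x * K x ^ (1 / p)) ^ p ∂μ) ^ (1 / p) *
        (∫⁻ x, (K x ^ (1 / p.conjExponent)) ^ p.conjExponent ∂μ) ^ (1 / p.conjExponent) :=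
        ENNReal.lintegral_mul_le_Lp_mul_Lq μ hpq (hw.mul (hK.pow_const _)) (hK.pow_const _)
    _ ≤ (∫⁻ x, w x ^ p * M ∂μ) ^ (1 / p) * 1 := by
        simp only [ENNReal.mul_rpow_of_nonneg _ _ hp0.le, ← ENNReal.rpow_mul,
          one_div_mul_cancel hp0.ne', one_div_mul_cancel hq0.ne', ENNReal.rpow_one]
        gcongr with x
        · exact hKM x
        · exact ENNReal.rpow_le_one hK1 (by positivity)
    _ = (∫⁻ x, w x ^ p ∂μ) ^ (1 / p) * M ^ (1 / p) := by
        rw [lintegral_mul_const' _ _ hM, ENNReal.mul_rpow_of_nonneg _ _ (by positivity), mul_one]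

theorem lintegral_ofReal_gaussProd {c : Fin N → ℝ} (hc : ∀ i, 0 < c i) :
    ∫⁻ x : 𝔼, ENNReal.ofReal (gaussProd c x) = 1 := by
  rw [← ofReal_integral_eq_lintegral_ofReal (integrable_gaussProd hc)
    (.of_forall fun x => gaussProd_nonneg _ _), integral_gaussProd hc, ENNReal.ofReal_one]

theorem pos_of_pos_of_one_le {i : Fin N} {c : Fin N → ℝ} (hi : 0 < c i)
    (hc : ∀ j, j ≠ i → 1 ≤ c j) (j : Fin N) : 0 < c j := by
  rcases eq_or_ne j i with rfl | hj
  · exact hi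
  · exact one_pos.trans_le (hc j hj)

theorem exists_lintegral_mul_testFun_le {p : ℝ} (hp : 1 < p) : ∃ C : ℝ, 0 < C ∧
    ∀ (i : Fin N) (c : Fin N → ℝ), 0 < c i → (∀ j, j ≠ i → 1 ≤ c j) →
      ∀ w : 𝔼 → ℝ≥0∞, AEMeasurable w → ∫⁻ x, w x * ENNReal.ofReal |testFun i c x| ≤
        (∫⁻ x, w x ^ p) ^ (1 / p) * ENNReal.ofReal (C * c i ^ (-(5 / 2) - 1 / (2 * p))) := by
  obtain ⟨C, hC, h⟩ := exists_abs_rpow_mul_testFun_le (N := N) le_rfl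
  refine ⟨C, hC, fun i c hi hc w hw => ?_⟩
  have h_pos := update_two_mul_pos i (pos_of_pos_of_one_le hi hc)
  have h_holder := lintegral_mul_le_rpow_of_le hp hw
    (continuous_gaussProd (Function.update c i (2 * c i))).measurable.ennreal_ofReal.aemeasurable
    ENNReal.ofReal_ne_top (fun x => ENNReal.ofReal_le_ofReal (gaussProd_update_le hi hc x))
    (lintegral_ofReal_gaussProd h_pos).le
  calc ∫⁻ x, w x * ENNReal.ofReal |testFun i c x|
      ≤ ∫⁻ x, ENNReal.ofReal (C * c i ^ (-(5 / 2) : ℝ)) *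
          (w x * ENNReal.ofReal (gaussProd (Function.update c i (2 * c i)) x)) := by
        refine lintegral_mono fun x => ?_
        rw [mul_left_comm, ← ENNReal.ofReal_mul (by positivity)]
        gcongr
        simpa only [Real.rpow_zero, one_mul, zero_div, zero_sub] using h i c hi x
    _ ≤ ENNReal.ofReal (C * c i ^ (-(5 / 2) : ℝ)) * ((∫⁻ x, w x ^ p) ^ (1 / p) *
          ENNReal.ofReal (c i ^ (-(1 / 2) : ℝ)) ^ (1 / p)) := by
        rw [lintegral_const_mul' _ _ ENNReal.ofReal_ne_top]
        gcongr
    _ = _ := by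
        rw [mul_left_comm, ENNReal.ofReal_rpow_of_pos (by positivity), ← Real.rpow_mul hi.le,
          ← ENNReal.ofReal_mul (by positivity), mul_assoc, ← Real.rpow_add hi]
        congr 5
        ring

/-! ### A moment of the fifth derivative -/

theorem integrableOn_rpow_mul_exp_neg_sq_div {q : ℝ} (hq : -1 < q) :
    IntegrableOn (fun y : ℝ => y ^ q * Real.exp (-(y ^ 2 / 4))) (Ioi 0) := by
  have h := integrableOn_rpow_mul_exp_neg_mul_sq (b := 1 / 4) (by norm_num) hq
  simpa only [neg_mul, one_div_mul_eq_div] using h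

theorem integral_rpow_mul_exp_neg_sq_div {q : ℝ} (hq : -1 < q) :
    ∫ y in Ioi (0 : ℝ), y ^ q * Real.exp (-(y ^ 2 / 4)) =
      2 ^ q * Real.Gamma ((q + 1) / 2) := by
  have h := integral_rpow_mul_exp_neg_mul_rpow (p := 2) (b := 1 / 4) (by norm_num) hq
    (by norm_num)
  simp only [neg_mul, one_div_mul_eq_div, Real.rpow_two] at h
  rw [h, show (1 / 4 : ℝ) = 2 ^ (-2 : ℝ) by norm_num [Real.rpow_neg], ← Real.rpow_mul two_pos.le,
    show (-2 : ℝ) * (-(q + 1) / 2) = q + 1 by ring, Real.rpow_add_one two_ne_zero]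
  ring

theorem integral_rpow_add_two_mul_exp_neg_sq_div {q : ℝ} (hq : -1 < q) :
    ∫ y in Ioi (0 : ℝ), y ^ (q + 2) * Real.exp (-(y ^ 2 / 4)) =
      2 * (q + 1) * ∫ y in Ioi (0 : ℝ), y ^ q * Real.exp (-(y ^ 2 / 4)) := by
  rw [integral_rpow_mul_exp_neg_sq_div hq, integral_rpow_mul_exp_neg_sq_div (by linarith),
    show (q + 2 + 1) / 2 = (q + 1) / 2 + 1 by ring, Real.Gamma_add_one (by linarith),
    Real.rpow_add two_pos]
  norm_num
  ring

theorem rpow_mul_self_mul_fifthDerivGauss_one {α y : ℝ} (hy : 0 < y) :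
    y ^ α * y * fifthDerivGauss 1 y = (√(4 * Real.pi))⁻¹ *
      (-(1 / 32) * (y ^ (α + 2 + 2 + 2) * Real.exp (-(y ^ 2 / 4))) +
        5 / 8 * (y ^ (α + 2 + 2) * Real.exp (-(y ^ 2 / 4))) -
        15 / 8 * (y ^ (α + 2) * Real.exp (-(y ^ 2 / 4)))) := by
  simp only [Real.rpow_add hy, Real.rpow_two, fifthDerivGauss, gauss, mul_one]
  ring

theorem integral_Ioi_rpow_mul_fifthDerivGauss_one {α : ℝ} (hα : -3 < α) :
    ∫ y in Ioi (0 : ℝ), y ^ α * y * fifthDerivGauss 1 y = (√(4 * Real.pi))⁻¹ *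
      (α * (2 - α) / 8 * ∫ y in Ioi (0 : ℝ), y ^ (α + 2) * Real.exp (-(y ^ 2 / 4))) := by
  have h_int : ∀ (k : ℝ) {q : ℝ}, -1 < q →
      Integrable (fun y : ℝ => k * (y ^ q * Real.exp (-(y ^ 2 / 4)))) (volume.restrict (Ioi 0)) :=
    fun k _ hq => (integrableOn_rpow_mul_exp_neg_sq_div hq).const_mul k
  have h₂ := h_int (15 / 8) (q := α + 2) (by linarith)
  have h₄ := h_int (5 / 8) (q := α + 2 + 2) (by linarith)
  have h₆ := h_int (-(1 / 32)) (q := α + 2 + 2 + 2) (by linarith)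
  have h₆₄ : Integrable (fun y : ℝ => -(1 / 32) * (y ^ (α + 2 + 2 + 2) * Real.exp (-(y ^ 2 / 4))) +
      5 / 8 * (y ^ (α + 2 + 2) * Real.exp (-(y ^ 2 / 4)))) (volume.restrict (Ioi 0)) := h₆.add h₄
  rw [setIntegral_congr_fun measurableSet_Ioi fun y hy => rpow_mul_self_mul_fifthDerivGauss_one hy,
    integral_const_mul, integral_sub h₆₄ h₂, integral_add h₆ h₄,
    integral_const_mul, integral_const_mul, integral_const_mul,
    integral_rpow_add_two_mul_exp_neg_sq_div (by linarith : -1 < α + 2 + 2),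
    integral_rpow_add_two_mul_exp_neg_sq_div (by linarith : -1 < α + 2)]
  ring

theorem integral_abs_rpow_mul_fifthDerivGauss_one_pos {α : ℝ} (hα₀ : 0 < α) (hα₂ : α < 2) :
    0 < ∫ y : ℝ, |y| ^ α * y * fifthDerivGauss 1 y := by
  have h_even : ∀ y : ℝ, |y| ^ α * y * fifthDerivGauss 1 y =
      |y| ^ α * |y| * fifthDerivGauss 1 |y| := fun y => by
    rcases abs_choice y with h | h
    · rw [h]
    · rw [h, fifthDerivGauss_neg]
      ring
  simp_rw [h_even]
  rw [integral_comp_abs (f := fun r : ℝ => r ^ α * r * fifthDerivGauss 1 r),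
    integral_Ioi_rpow_mul_fifthDerivGauss_one (by linarith),
    integral_rpow_mul_exp_neg_sq_div (by linarith)]
  have := Real.Gamma_pos_of_pos (by linarith : 0 < (α + 2 + 1) / 2)
  have := sub_pos.2 hα₂
  positivity

theorem integral_abs_rpow_mul_fifthDerivGauss (α : ℝ) {a : ℝ} (ha : 0 < a) :
    ∫ y : ℝ, |y| ^ α * y * fifthDerivGauss a y =
      (∫ y : ℝ, |y| ^ α * y * fifthDerivGauss 1 y) * a ^ (α / 2 - 2) := by
  obtain ⟨r, hr, rfl⟩ : ∃ r : ℝ, 0 < r ∧ a = r ^ 2 :=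
    ⟨√a, Real.sqrt_pos.2 ha, (Real.sq_sqrt ha.le).symm⟩
  have h_scale : ∀ z : ℝ, |r * z| ^ α * (r * z) * fifthDerivGauss (r ^ 2) (r * z) =
      r ^ α * r * (r ^ 6)⁻¹ * (|z| ^ α * z * fifthDerivGauss 1 z) := fun z => by
    rw [fifthDerivGauss_sq hr, abs_mul, abs_of_pos hr, Real.mul_rpow hr.le (abs_nonneg z)]
    ring
  have h_power : r * (r ^ α * r * (r ^ 6)⁻¹) = (r ^ 2) ^ (α / 2 - 2) := by
    rw [← Real.rpow_natCast r 2, ← Real.rpow_mul hr.le,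
      show ((2 : ℕ) : ℝ) * (α / 2 - 2) = α - (4 : ℕ) by push_cast; ring,
      Real.rpow_sub_natCast hr.ne']
    field_simp
  have h_subst := Measure.integral_comp_mul_left
    (fun y => |y| ^ α * y * fifthDerivGauss (r ^ 2) y) r
  simp_rw [h_scale, integral_const_mul, abs_of_pos (inv_pos.2 hr), smul_eq_mul] at h_subst
  rw [← h_power, mul_comm (∫ y : ℝ, |y| ^ α * y * fifthDerivGauss 1 y), mul_assoc r, h_subst,
    mul_inv_cancel_left₀ hr.ne']

/-! ### The heat semigroup on functions vanishing at infinity -/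

theorem norm_apply_le (v : C₀(𝔼, ℂ)) (x : 𝔼) : ‖v x‖ ≤ ‖v‖ := v.toBCF.norm_coe_le_norm x

theorem norm_le_of_forall {v : C₀(𝔼, ℂ)} {C : ℝ} (hC : 0 ≤ C) (h : ∀ x, ‖v x‖ ≤ C) : ‖v‖ ≤ C :=
  (BoundedContinuousFunction.norm_le hC).2 h

/-- Evaluation at a point, as a continuous linear functional on `C₀`. -/
def evalCLM (x : 𝔼) : C₀(𝔼, ℂ) →L[ℂ] ℂ :=
  LinearMap.mkContinuous ⟨⟨fun v => v x, fun _ _ => rfl⟩, fun _ _ => rfl⟩ 1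
    fun v => by
      rw [one_mul]
      exact norm_apply_le v x

theorem evalCLM_apply (x : 𝔼) (v : C₀(𝔼, ℂ)) : evalCLM x v = v x := rfl

theorem integrable_smul_apply {g : 𝔼 → ℝ} (hg : Integrable g) (v : C₀(𝔼, ℂ)) :
    Integrable fun x => g x • v x :=
  hg.smul_bdd ‖v‖ v.continuous.aestronglyMeasurable (.of_forall (norm_apply_le v))

/-- Integration against an integrable function, as a continuous linear functional on `C₀`. -/
def pairCLM (g : 𝔼 → ℝ) (hg : Integrable g) : C₀(𝔼, ℂ) →L[ℂ] ℂ :=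
  LinearMap.mkContinuous
    ⟨⟨fun v => ∫ x, g x • v x, fun v w => by
      rw [← integral_add (integrable_smul_apply hg v) (integrable_smul_apply hg w)]
      simp only [ZeroAtInftyContinuousMap.add_apply, smul_add]⟩, fun c v => by
      rw [RingHom.id_apply, ← integral_smul]
      simp only [ZeroAtInftyContinuousMap.smul_apply, smul_comm c]⟩
    (∫ x, ‖g x‖) fun v => by
      rw [← integral_mul_const]
      refine norm_integral_le_of_norm_le (hg.norm.mul_const _) (.of_forall fun x => ?_)
      rw [norm_smul]
      gcongr
      exact norm_apply_le v x

theorem pairCLM_apply {g : 𝔼 → ℝ} (hg : Integrable g) (v : C₀(𝔼, ℂ)) :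
    pairCLM g hg v = ∫ x, g x • v x := rfl

/-- The translate `x ↦ v (x - h)`. -/
def translate (h : 𝔼) (v : C₀(𝔼, ℂ)) : C₀(𝔼, ℂ) :=
  v.comp ⟨⟨fun x => x - h, by fun_prop⟩,
    (Homeomorph.subRight h).isClosedEmbedding.tendsto_cocompact⟩

theorem translate_apply (h : 𝔼) (v : C₀(𝔼, ℂ)) (x : 𝔼) : translate h v x = v (x - h) := rfl

theorem translate_sub (h : 𝔼) (v w : C₀(𝔼, ℂ)) :
    translate h (v - w) = translate h v - translate h w := rfl

theorem norm_translate_le (h : 𝔼) (v : C₀(𝔼, ℂ)) : ‖translate h v‖ ≤ ‖v‖ :=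
  norm_le_of_forall (norm_nonneg v) fun x => norm_apply_le v (x - h)

theorem continuous_translate : Continuous fun q : 𝔼 × C₀(𝔼, ℂ) => translate q.1 q.2 := by
  refine continuous_prod_of_continuous_lipschitzWith' _ 1 (fun h => ?_) fun v => ?_
  · refine LipschitzWith.of_dist_le_mul fun v w => ?_
    rw [dist_eq_norm, dist_eq_norm, ← translate_sub, NNReal.coe_one, one_mul]
    exact norm_translate_le h _
  · refine Metric.continuous_iff.2 fun h ε hε => ?_
    obtain ⟨δ, hδ, h_unif⟩ := Metric.uniformContinuous_iff.1
      (ZeroAtInftyContinuousMap.uniformContinuous v) (ε / 2) (half_pos hε)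
    refine ⟨δ, hδ, fun h' hh => ?_⟩
    rw [dist_eq_norm]
    refine lt_of_le_of_lt (norm_le_of_forall (half_pos hε).le fun x => ?_) (half_lt_self hε)
    rw [ZeroAtInftyContinuousMap.sub_apply, translate_apply, translate_apply, ← dist_eq_norm]
    exact (h_unif (by rwa [dist_sub_left])).le

theorem integrable_gaussProd_one_mul (C : ℝ) :
    Integrable fun z : 𝔼 => gaussProd (fun _ => 1) z * C :=
  (integrable_gaussProd fun _ => one_pos).mul_const C

theorem norm_gaussProd_smul_translate_le (h z : 𝔼) (v : C₀(𝔼, ℂ)) :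
    ‖gaussProd (fun _ => 1) z • translate h v‖ ≤ gaussProd (fun _ => 1) z * ‖v‖ := by
  rw [norm_smul, Real.norm_of_nonneg (gaussProd_nonneg _ _)]
  exact mul_le_mul_of_nonneg_left (norm_translate_le _ v) (gaussProd_nonneg _ _)

theorem integrable_gaussProd_smul_translate (t : ℝ) (v : C₀(𝔼, ℂ)) :
    Integrable fun z : 𝔼 => gaussProd (fun _ => 1) z • translate (√t • z) v := by
  have h_translate : Continuous fun z : 𝔼 => translate (√t • z) v :=
    continuous_translate.comp (by fun_prop : Continuous fun z : 𝔼 => (√t • z, v))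
  exact (integrable_gaussProd_one_mul ‖v‖).mono'
    ((continuous_gaussProd _).smul h_translate).aestronglyMeasurable
    (.of_forall fun z => norm_gaussProd_smul_translate_le _ z v)

theorem norm_integral_gaussProd_smul_translate_le (t : ℝ) (v : C₀(𝔼, ℂ)) :
    ‖∫ z : 𝔼, gaussProd (fun _ => 1) z • translate (√t • z) v‖ ≤ ‖v‖ := by
  calc ‖∫ z : 𝔼, gaussProd (fun _ => 1) z • translate (√t • z) v‖
      ≤ ∫ z : 𝔼, gaussProd (fun _ => 1) z * ‖v‖ :=
        norm_integral_le_of_norm_le (integrable_gaussProd_one_mul ‖v‖)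
          (.of_forall fun z => norm_gaussProd_smul_translate_le _ z v)
    _ = ‖v‖ := by rw [integral_mul_const, integral_gaussProd (fun _ => one_pos), one_mul]

/-- The heat semigroup on `C₀`. The substitution `y = x - √t z` in the convolution with the heat
kernel turns it into an average of translations, which also covers `t = 0`. -/
def heatOp (t : ℝ) : C₀(𝔼, ℂ) →L[ℝ] C₀(𝔼, ℂ) :=
  LinearMap.mkContinuous
    ⟨⟨fun v => ∫ z : 𝔼, gaussProd (fun _ => 1) z • translate (√t • z) v, fun v w => by
      rw [← integral_add (integrable_gaussProd_smul_translate t v)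
        (integrable_gaussProd_smul_translate t w)]
      exact integral_congr_ae (.of_forall fun z =>
        ZeroAtInftyContinuousMap.ext fun x =>
          smul_add (gaussProd (fun _ => 1) z) (v (x - √t • z)) (w (x - √t • z)))⟩, fun r v => by
      rw [RingHom.id_apply, ← integral_smul]
      exact integral_congr_ae (.of_forall fun z =>
        ZeroAtInftyContinuousMap.ext fun x =>
          smul_comm (gaussProd (fun _ => 1) z) r (v (x - √t • z)))⟩
    1 fun v => by
      rw [one_mul]
      exact norm_integral_gaussProd_smul_translate_le t v

theorem norm_heatOp_le_one (t : ℝ) : ‖heatOp (N := N) t‖ ≤ 1 :=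
  LinearMap.mkContinuous_norm_le _ zero_le_one _

theorem heatOp_apply (t : ℝ) (v : C₀(𝔼, ℂ)) (x : 𝔼) :
    heatOp t v x = ∫ z : 𝔼, gaussProd (fun _ => 1) z • v (x - √t • z) :=
  (ContinuousLinearMap.integral_comp_comm (evalCLM x)
    (integrable_gaussProd_smul_translate t v)).symm

theorem continuous_heatOp (v : C₀(𝔼, ℂ)) : Continuous fun t => heatOp t v := by
  refine continuous_of_dominated
    (fun t => (integrable_gaussProd_smul_translate t v).aestronglyMeasurable)
    (fun t => .of_forall fun z => norm_gaussProd_smul_translate_le _ z v)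
    (integrable_gaussProd_one_mul ‖v‖) (.of_forall fun z => ?_)
  have h_translate : Continuous fun t : ℝ => translate (√t • z) v :=
    continuous_translate.comp (by fun_prop : Continuous fun t : ℝ => (√t • z, v))
  exact h_translate.const_smul (gaussProd (fun _ => 1) z)

theorem heatSemigroup_eq {t : ℝ} (ht : 0 < t) (f : 𝔼 → ℂ) (x : 𝔼) :
    heatSemigroup t f x = ∫ y, gaussProd (fun _ => t) (x - y) • f y := by
  simp only [heatSemigroup, if_pos ht, heatKernel_eq_gaussProd ht]

theorem gaussProd_sq_smul {r : ℝ} (hr : 0 < r) (z : 𝔼) :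
    gaussProd (fun _ => r ^ 2) (r • z) = (r ^ N)⁻¹ * gaussProd (fun _ => 1) z := by
  have h_gauss : ∀ y, gauss (r ^ 2) (r * y) = r⁻¹ * gauss 1 y := fun y => by
    simpa only [mul_one] using gauss_sq_mul hr 1 y
  simp only [gaussProd, PiLp.smul_apply, smul_eq_mul, h_gauss, Finset.prod_mul_distrib,
    Finset.prod_const, Finset.card_univ, Fintype.card_fin, inv_pow]

theorem heatSemigroup_eq_heatOp (t : ℝ) (v : C₀(𝔼, ℂ)) (x : 𝔼) :
    heatSemigroup t v x = heatOp t v x := by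
  rw [heatOp_apply]
  rcases lt_or_ge 0 t with ht | ht
  · obtain ⟨r, hr, rfl⟩ : ∃ r : ℝ, 0 < r ∧ t = r ^ 2 :=
      ⟨√t, Real.sqrt_pos.2 ht, (Real.sq_sqrt ht.le).symm⟩
    have h_subst := Measure.integral_comp_smul (volume : Measure 𝔼)
      (fun w => gaussProd (fun _ => r ^ 2) w • v (x - w)) r
    simp only [finrank_euclideanSpace, Fintype.card_fin, gaussProd_sq_smul hr, mul_smul,
      integral_smul, abs_of_pos (inv_pos.2 (pow_pos hr N))] at h_subst
    rw [heatSemigroup_eq ht, ← integral_sub_left_eq_self _ volume x, Real.sqrt_sq hr.le]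
    simp only [sub_sub_cancel]
    exact (smul_right_injective ℂ (inv_pos.2 (pow_pos hr N)).ne' h_subst).symm
  · simp only [Real.sqrt_eq_zero_of_nonpos ht, zero_smul, sub_zero]
    rw [integral_smul_const, integral_gaussProd (fun _ => one_pos), one_smul, heatSemigroup,
      if_neg ht.not_gt]

theorem integrable_prod_testFun_mul_gaussProd (i : Fin N) {c : Fin N → ℝ} (hc : ∀ j, 0 < c j)
    {τ : ℝ} (hτ : 0 < τ) :
    Integrable fun q : 𝔼 × 𝔼 => testFun i c q.1 * gaussProd (fun _ => τ) (q.1 - q.2) := by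
  have h_conv := Integrable.convolution_integrand (ContinuousLinearMap.mul ℝ ℝ) (μ := volume)
    (integrable_testFun i hc) (integrable_gaussProd fun _ : Fin N => hτ)
  refine h_conv.swap.congr (.of_forall fun q => ?_)
  simp only [Function.comp_def, Prod.fst_swap, Prod.snd_swap, ContinuousLinearMap.mul_apply']
  rw [← neg_sub, gaussProd_neg]

theorem integral_testFun_smul_heatOp (i : Fin N) {c : Fin N → ℝ} (hc : ∀ j, 0 < c j) {τ : ℝ}
    (hτ : 0 ≤ τ) (v : C₀(𝔼, ℂ)) :
    ∫ x, testFun i c x • heatOp τ v x = ∫ x, testFun i (fun j => c j + τ) x • v x := by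
  rcases hτ.eq_or_lt with rfl | hτ
  · simp only [add_zero, ← heatSemigroup_eq_heatOp, heatSemigroup, lt_irrefl, if_false]
  have h_integrable : Integrable fun q : 𝔼 × 𝔼 =>
      (testFun i c q.1 * gaussProd (fun _ => τ) (q.1 - q.2)) • v q.2 :=
    (integrable_prod_testFun_mul_gaussProd i hc hτ).smul_bdd ‖v‖
      (by fun_prop : Continuous fun q : 𝔼 × 𝔼 => v q.2).aestronglyMeasurable
      (.of_forall fun q => norm_apply_le v q.2)
  simp only [← heatSemigroup_eq_heatOp, heatSemigroup_eq hτ, ← integral_smul, smul_smul]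
  rw [integral_integral_swap h_integrable]
  refine integral_congr_ae (.of_forall fun y => ?_)
  dsimp only
  rw [integral_smul_const, ← integral_gaussProd_mul_testFun i hτ hc]
  congr 2
  ext x
  rw [← neg_sub, gaussProd_neg, mul_comm]

/-! ### Mild solutions of semilinear evolution equations -/

section MildSolutions

variable {X : Type*} [NormedAddCommGroup X] [NormedSpace ℝ X] {S : ℝ → X →L[ℝ] X} {F : X → X}
  {φ : X} {u v : ℝ → X} {b t : ℝ}

/-- The right-hand side of Duhamel's formula for `u' = A u + F u`, `u 0 = φ`, where `A` generates
the semigroup `S`. -/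
def mildMap (S : ℝ → X →L[ℝ] X) (F : X → X) (φ : X) (u : ℝ → X) (t : ℝ) : X :=
  S t φ + ∫ s in (0 : ℝ)..t, S (t - s) (F (u s))

/-- The standing assumptions for the abstract equation `u' = A u + F u`: a strongly continuous
family of linear contractions and a nonlinearity which is Lipschitz on bounded sets. -/
structure IsMildPair (S : ℝ → X →L[ℝ] X) (F : X → X) : Prop where
  continuous_apply : ∀ v, Continuous fun t => S t v
  norm_le_one : ∀ t, ‖S t‖ ≤ 1
  lipschitzOnWith : ∀ R, ∃ K, LipschitzOnWith K F (Metric.closedBall 0 R)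

theorem eq_zero_of_le_mul_integral {w : ℝ → ℝ} {B : ℝ} (hw : ContinuousOn w (Icc 0 b))
    (hw₀ : ∀ t ∈ Icc 0 b, 0 ≤ w t) (hB : ∀ t ∈ Icc 0 b, w t ≤ B * ∫ s in (0 : ℝ)..t, w s) :
    ∀ t ∈ Icc 0 b, w t = 0 := by
  intro t ht
  have h_int : IntegrableOn w (Icc 0 b) := hw.integrableOn_Icc
  have h_cont : ContinuousOn (fun t => ∫ s in (0 : ℝ)..t, w s) (Icc 0 b) := by
    rw [← uIcc_of_le (ht.1.trans ht.2)] at h_int ⊢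
    exact intervalIntegral.continuousOn_primitive_interval h_int
  have h_deriv : ∀ t ∈ Ico 0 b,
      HasDerivWithinAt (fun t => ∫ s in (0 : ℝ)..t, w s) (w t) (Ici t) t := fun t ht => by
    have h_nhds : Icc 0 b ∈ 𝓝[>] t :=
      mem_of_superset (Ioc_mem_nhdsGT ht.2) fun s hs => ⟨ht.1.trans hs.1.le, hs.2⟩
    refine intervalIntegral.integral_hasDerivWithinAt_right
      ((hw.mono (Icc_subset_Icc_right ht.2.le)).intervalIntegrable_of_Icc ht.1)
      ⟨Icc 0 b, h_nhds, hw.aestronglyMeasurable measurableSet_Icc⟩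
      ((hw t ⟨ht.1, ht.2.le⟩).mono_of_mem_nhdsWithin h_nhds)
  have h_bound : ∀ t ∈ Ico 0 b, ‖w t‖ ≤ B * ‖∫ s in (0 : ℝ)..t, w s‖ := fun t ht => by
    have ht' := Ico_subset_Icc_self ht
    rw [Real.norm_of_nonneg (hw₀ t ht'), Real.norm_of_nonneg
      (intervalIntegral.integral_nonneg ht.1 fun s hs => hw₀ s ⟨hs.1, hs.2.trans ht.2.le⟩)]
    exact hB t ht'
  have h_zero := eq_zero_of_abs_deriv_le_mul_abs_self_of_eq_zero_right h_cont h_deriv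
    intervalIntegral.integral_same h_bound t ht
  exact le_antisymm (by simpa only [h_zero, mul_zero] using hB t ht) (hw₀ t ht)

namespace IsMildPair

theorem continuous_uncurry (h : IsMildPair S F) : Continuous fun q : ℝ × X => S q.1 q.2 :=
  continuous_prod_of_continuous_lipschitzWith' _ 1
    (fun t => (S t).lipschitz.weaken (h.norm_le_one t)) h.continuous_apply

theorem norm_apply_le (h : IsMildPair S F) (t : ℝ) (v : X) : ‖S t v‖ ≤ ‖v‖ := by
  simpa only [one_mul] using (S t).le_of_opNorm_le (h.norm_le_one t) v

theorem continuous (h : IsMildPair S F) : Continuous F := by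
  refine LocallyLipschitz.continuous fun v => ?_
  obtain ⟨K, hK⟩ := h.lipschitzOnWith (‖v‖ + 1)
  exact ⟨K, _, Metric.closedBall_mem_nhds_of_mem (by simp), hK⟩

theorem continuousOn_integrand (h : IsMildPair S F) (hu : ContinuousOn u (Icc 0 t)) :
    ContinuousOn (fun s => S (t - s) (F (u s))) (Icc 0 t) :=
  h.continuous_uncurry.comp_continuousOn <|
    (continuousOn_const.sub continuousOn_id).prodMk (h.continuous.comp_continuousOn hu)

theorem intervalIntegrable_integrand (h : IsMildPair S F) (ht : 0 ≤ t)
    (hu : ContinuousOn u (Icc 0 t)) :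
    IntervalIntegrable (fun s => S (t - s) (F (u s))) volume 0 t :=
  (h.continuousOn_integrand hu).intervalIntegrable_of_Icc ht

theorem norm_mildMap_sub_le (h : IsMildPair S F) {s : Set X} {K : NNReal}
    (hF : LipschitzOnWith K F s) (ht : 0 ≤ t) (hu : ContinuousOn u (Icc 0 t))
    (hv : ContinuousOn v (Icc 0 t)) (hus : ∀ r ∈ Icc 0 t, u r ∈ s) (hvs : ∀ r ∈ Icc 0 t, v r ∈ s) :
    ‖mildMap S F φ u t - mildMap S F φ v t‖ ≤ K * ∫ r in (0 : ℝ)..t, ‖u r - v r‖ := by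
  rw [mildMap, mildMap, add_sub_add_left_eq_sub, ← intervalIntegral.integral_sub
    (h.intervalIntegrable_integrand ht hu) (h.intervalIntegrable_integrand ht hv),
    ← intervalIntegral.integral_const_mul]
  refine intervalIntegral.norm_integral_le_of_norm_le ht (.of_forall fun r hr => ?_)
    ((hu.sub hv).norm.const_mul _ |>.intervalIntegrable_of_Icc ht)
  have hr' := Ioc_subset_Icc_self hr
  rw [← map_sub]
  exact (h.norm_apply_le _ _).trans (hF.norm_sub_le (hus r hr') (hvs r hr'))

theorem norm_mildMap_le (h : IsMildPair S F) {M : ℝ} (ht : 0 ≤ t)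
    (hM : ∀ r ∈ Icc 0 t, ‖F (u r)‖ ≤ M) : ‖mildMap S F φ u t‖ ≤ ‖φ‖ + M * t := by
  have h_int : ‖∫ r in (0 : ℝ)..t, S (t - r) (F (u r))‖ ≤ M * |t - 0| :=
    intervalIntegral.norm_integral_le_of_norm_le_const fun r hr => by
      rw [uIoc_of_le ht] at hr
      exact (h.norm_apply_le _ _).trans (hM r (Ioc_subset_Icc_self hr))
  rw [sub_zero, abs_of_nonneg ht] at h_int
  exact (norm_add_le _ _).trans (add_le_add (h.norm_apply_le _ _) h_int)

theorem continuous_mildMap (h : IsMildPair S F) (hu : Continuous u) :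
    Continuous (mildMap S F φ u) := by
  have h_integrand : Continuous fun q : ℝ × ℝ => S (q.1 - q.2) (F (u q.2)) :=
    h.continuous_uncurry.comp <| (continuous_fst.sub continuous_snd).prodMk
      (h.continuous.comp (hu.comp continuous_snd))
  exact (h.continuous_apply φ).add
    (intervalIntegral.continuous_parametric_intervalIntegral_of_continuous (μ := volume) (a₀ := 0)
      (f := fun t s => S (t - s) (F (u s))) h_integrand continuous_id)

theorem eqOn_of_mildMap (h : IsMildPair S F) (hu : ContinuousOn u (Icc 0 b))
    (hv : ContinuousOn v (Icc 0 b)) (hu' : ∀ t ∈ Icc 0 b, u t = mildMap S F φ u t)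
    (hv' : ∀ t ∈ Icc 0 b, v t = mildMap S F φ v t) : EqOn u v (Icc 0 b) := by
  obtain ⟨R₁, hR₁⟩ := isCompact_Icc.exists_bound_of_continuousOn hu
  obtain ⟨R₂, hR₂⟩ := isCompact_Icc.exists_bound_of_continuousOn hv
  obtain ⟨K, hK⟩ := h.lipschitzOnWith (max R₁ R₂)
  refine fun t ht => sub_eq_zero.1 <| norm_eq_zero.1 <|
    eq_zero_of_le_mul_integral (w := fun t => ‖u t - v t‖) (B := K) (hu.sub hv).norm
      (fun _ _ => norm_nonneg _) (fun t ht => ?_) t ht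
  have h_sub : Icc 0 t ⊆ Icc 0 b := Icc_subset_Icc_right ht.2
  conv_lhs => rw [hu' t ht, hv' t ht]
  exact h.norm_mildMap_sub_le hK ht.1 (hu.mono h_sub) (hv.mono h_sub)
    (fun s hs => mem_closedBall_zero_iff.2 ((hR₁ s (h_sub hs)).trans (le_max_left _ _)))
    (fun s hs => mem_closedBall_zero_iff.2 ((hR₂ s (h_sub hs)).trans (le_max_right _ _)))

/-- The Picard map `u ↦ mildMap S F φ u` on the continuous functions on `[0, τ]`; a function on
`[0, τ]` is extended to `ℝ` by its end values. -/
def picardMap (h : IsMildPair S F) (φ : X) {τ : ℝ} (hτ : 0 ≤ τ) (w : C(Icc (0 : ℝ) τ, X)) :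
    C(Icc (0 : ℝ) τ, X) where
  toFun t := mildMap S F φ (IccExtend hτ w) t
  continuous_toFun := (h.continuous_mildMap w.continuous.Icc_extend').comp continuous_subtype_val

theorem mapsTo_picardMap (h : IsMildPair S F) {τ R M : ℝ} (hτ : 0 ≤ τ)
    (hM : ∀ v ∈ Metric.closedBall 0 R, ‖F v‖ ≤ M) (hM₀ : 0 ≤ M) (hR : ‖φ‖ + M * τ ≤ R) :
    MapsTo (h.picardMap φ hτ) (Metric.closedBall 0 R) (Metric.closedBall 0 R) := by
  intro w hw
  rw [mem_closedBall_zero_iff] at hw ⊢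
  refine (ContinuousMap.norm_le _ ((norm_nonneg w).trans hw)).2 fun t => ?_
  calc ‖mildMap S F φ (IccExtend hτ w) t‖
      ≤ ‖φ‖ + M * t := h.norm_mildMap_le t.2.1 fun r _ =>
        hM _ (mem_closedBall_zero_iff.2 ((w.norm_coe_le_norm _).trans hw))
    _ ≤ ‖φ‖ + M * τ := by
        gcongr
        exact t.2.2
    _ ≤ R := hR

theorem dist_picardMap_le (h : IsMildPair S F) {τ R : ℝ} (hτ : 0 ≤ τ) {K : NNReal}
    (hK : LipschitzOnWith K F (Metric.closedBall 0 R)) {w₁ w₂ : C(Icc (0 : ℝ) τ, X)}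
    (h₁ : w₁ ∈ Metric.closedBall 0 R) (h₂ : w₂ ∈ Metric.closedBall 0 R) :
    dist (h.picardMap φ hτ w₁) (h.picardMap φ hτ w₂) ≤ K * τ * dist w₁ w₂ := by
  have h_ball : ∀ {w : C(Icc (0 : ℝ) τ, X)}, w ∈ Metric.closedBall 0 R →
      ∀ r, IccExtend hτ w r ∈ Metric.closedBall 0 R := fun {w} hw r =>
    mem_closedBall_zero_iff.2 ((w.norm_coe_le_norm _).trans (mem_closedBall_zero_iff.1 hw))
  have h_cont : ∀ w : C(Icc (0 : ℝ) τ, X), Continuous (IccExtend hτ w) :=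
    fun w => w.continuous.Icc_extend'
  refine (ContinuousMap.dist_le (by positivity)).2 fun t => ?_
  have h_int : ∫ r in (0 : ℝ)..t, ‖IccExtend hτ w₁ r - IccExtend hτ w₂ r‖ ≤ t * dist w₁ w₂ := by
    calc ∫ r in (0 : ℝ)..t, ‖IccExtend hτ w₁ r - IccExtend hτ w₂ r‖
        ≤ ∫ _ in (0 : ℝ)..t, dist w₁ w₂ :=
          intervalIntegral.integral_mono_on t.2.1
            (((h_cont w₁).sub (h_cont w₂)).norm.intervalIntegrable _ _) intervalIntegrable_const
            fun r _ => by
              rw [← dist_eq_norm]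
              exact ContinuousMap.dist_apply_le_dist _
      _ = t * dist w₁ w₂ := by simp
  calc dist (h.picardMap φ hτ w₁ t) (h.picardMap φ hτ w₂ t)
      ≤ K * ∫ r in (0 : ℝ)..t, ‖IccExtend hτ w₁ r - IccExtend hτ w₂ r‖ := by
        rw [dist_eq_norm]
        exact h.norm_mildMap_sub_le hK t.2.1 (h_cont w₁).continuousOn (h_cont w₂).continuousOn
          (fun r _ => h_ball h₁ r) (fun r _ => h_ball h₂ r)
    _ ≤ K * (τ * dist w₁ w₂) := by
        gcongr
        exact h_int.trans (by gcongr; exact t.2.2)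
    _ = K * τ * dist w₁ w₂ := by ring

theorem exists_local_solution [CompleteSpace X] (h : IsMildPair S F) (φ : X) :
    ∃ τ : ℝ, 0 < τ ∧ ∃ u : ℝ → X, Continuous u ∧ ∀ t ∈ Icc 0 τ, u t = mildMap S F φ u t := by
  obtain ⟨K, hK⟩ := h.lipschitzOnWith (‖φ‖ + 1)
  have h_zero : (0 : X) ∈ Metric.closedBall 0 (‖φ‖ + 1) :=
    Metric.mem_closedBall_self (by positivity)
  let M : ℝ := ‖F 0‖ + K * (‖φ‖ + 1)
  have hM : ∀ v ∈ Metric.closedBall 0 (‖φ‖ + 1), ‖F v‖ ≤ M := fun v hv => by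
    have h_sub := hK.norm_sub_le hv h_zero
    rw [sub_zero] at h_sub
    calc ‖F v‖ ≤ ‖F 0‖ + ‖F v - F 0‖ := norm_le_norm_add_norm_sub' _ _
      _ ≤ ‖F 0‖ + K * (‖φ‖ + 1) := by
          gcongr
          exact h_sub.trans (by gcongr; exact mem_closedBall_zero_iff.1 hv)
  let τ : ℝ := 1 / (M + 2 * K + 1)
  have hM₀ : 0 ≤ M := by positivity
  have hτ : 0 < τ := by positivity
  have hMτ : M * τ ≤ 1 := by
    rw [mul_one_div, div_le_one (by positivity)]
    linarith [K.2]
  have hKτ : (K * τ : ℝ) ≤ 1 / 2 := by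
    rw [mul_one_div, div_le_iff₀ (by positivity)]
    linarith
  have h_maps := h.mapsTo_picardMap (φ := φ) hτ.le hM hM₀ (by linarith)
  have h_contracting : ContractingWith (1 / 2) (h_maps.restrict _ _ _) := by
    refine ⟨by rw [← NNReal.coe_lt_coe]; norm_num, LipschitzWith.of_dist_le_mul fun w₁ w₂ => ?_⟩
    refine (h.dist_picardMap_le hτ.le hK w₁.2 w₂.2).trans ?_
    rw [Subtype.dist_eq]
    gcongr
    simpa using hKτ
  obtain ⟨w, -, hw, -⟩ := h_contracting.exists_fixedPoint' Metric.isClosed_closedBall.isComplete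
    h_maps (Metric.mem_closedBall_self (by positivity)) (edist_ne_top _ _)
  refine ⟨τ, hτ, IccExtend hτ.le w, w.continuous.Icc_extend', fun t ht => ?_⟩
  rw [IccExtend_of_mem hτ.le w ht]
  exact (DFunLike.congr_fun hw ⟨t, ht⟩).symm

end IsMildPair

end MildSolutions

/-! ### The maximal solution -/

theorem continuous_powerNonlinearity {α : ℝ} (hα : 0 < α) : Continuous (powerNonlinearity α) :=
  (Complex.continuous_ofReal.comp
    (continuous_norm.rpow_const fun _ => Or.inr hα.le)).mul continuous_id

theorem sub_rpow_mul_le {α r ρ : ℝ} (hα : 0 ≤ α) (hρ : 0 ≤ ρ) (h : ρ ≤ r) :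
    (r ^ α - ρ ^ α) * ρ ≤ (1 + α) * r ^ α * (r - ρ) := by
  rcases (hρ.trans h).eq_or_lt with hr | hr
  · have hρ' : ρ = 0 := le_antisymm (h.trans hr.symm.le) hρ
    simp [← hr, hρ']
  have h_quot : 0 ≤ ρ / r := by positivity
  have h_bernoulli := one_add_mul_self_le_rpow_one_add (s := ρ / r - 1) (p := 1 + α)
    (by linarith) (by linarith)
  rw [add_sub_cancel, Real.div_rpow hρ hr.le, Real.rpow_one_add' hρ (by linarith),
    Real.rpow_one_add' hr.le (by linarith), le_div_iff₀ (by positivity)] at h_bernoulli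
  have h_expand : (1 + (1 + α) * (ρ / r - 1)) * (r * r ^ α) =
      r * r ^ α - (1 + α) * r ^ α * (r - ρ) := by
    field_simp
    ring
  nlinarith [Real.rpow_nonneg hr.le α]

theorem norm_powerNonlinearity_sub_le {α : ℝ} (hα : 0 ≤ α) {R : ℝ} {z w : ℂ} (hz : ‖z‖ ≤ R)
    (hw : ‖w‖ ≤ R) :
    ‖powerNonlinearity α z - powerNonlinearity α w‖ ≤ (2 + α) * R ^ α * ‖z - w‖ := by
  wlog h : ‖w‖ ≤ ‖z‖ generalizing z w
  · rw [norm_sub_rev, norm_sub_rev z]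
    exact this hw hz (le_of_not_ge h)
  have h_split : powerNonlinearity α z - powerNonlinearity α w =
      ((‖z‖ ^ α : ℝ) : ℂ) * (z - w) + ((‖z‖ ^ α - ‖w‖ ^ α : ℝ) : ℂ) * w := by
    simp only [powerNonlinearity]
    push_cast
    ring
  have h_mono : ‖w‖ ^ α ≤ ‖z‖ ^ α := by gcongr
  calc ‖powerNonlinearity α z - powerNonlinearity α w‖
      ≤ ‖z‖ ^ α * ‖z - w‖ + (‖z‖ ^ α - ‖w‖ ^ α) * ‖w‖ := by
        rw [h_split]
        refine (norm_add_le _ _).trans (le_of_eq ?_)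
        rw [norm_mul, norm_mul, Complex.norm_real, Complex.norm_real,
          Real.norm_of_nonneg (by positivity), Real.norm_of_nonneg (sub_nonneg.2 h_mono)]
    _ ≤ ‖z‖ ^ α * ‖z - w‖ + (1 + α) * ‖z‖ ^ α * (‖z‖ - ‖w‖) := by
        exact add_le_add le_rfl (sub_rpow_mul_le hα (norm_nonneg w) h)
    _ ≤ ‖z‖ ^ α * ‖z - w‖ + (1 + α) * ‖z‖ ^ α * ‖z - w‖ := by
        gcongr
        exact norm_sub_norm_le z w
    _ = (2 + α) * ‖z‖ ^ α * ‖z - w‖ := by ring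
    _ ≤ (2 + α) * R ^ α * ‖z - w‖ := by gcongr

/-- The Nemytskii operator `v ↦ |v|^α v` of the power nonlinearity on `C₀`. -/
def powerC₀ (α : ℝ) (hα : 0 < α) (v : C₀(𝔼, ℂ)) : C₀(𝔼, ℂ) where
  toFun x := powerNonlinearity α (v x)
  continuous_toFun := (continuous_powerNonlinearity hα).comp v.continuous
  zero_at_infty' := by
    have h := ((continuous_powerNonlinearity hα).tendsto 0).comp v.zero_at_infty'
    rwa [show powerNonlinearity α 0 = 0 by simp [powerNonlinearity]] at h

@[simp]
theorem powerC₀_apply {α : ℝ} (hα : 0 < α) (v : C₀(𝔼, ℂ)) (x : 𝔼) :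
    powerC₀ α hα v x = powerNonlinearity α (v x) := rfl

theorem norm_powerC₀_sub_le {α : ℝ} (hα : 0 < α) {R : ℝ} {v w : C₀(𝔼, ℂ)} (hv : ‖v‖ ≤ R)
    (hw : ‖w‖ ≤ R) : ‖powerC₀ α hα v - powerC₀ α hα w‖ ≤ (2 + α) * R ^ α * ‖v - w‖ := by
  have hR := (norm_nonneg v).trans hv
  refine norm_le_of_forall (by positivity) fun x => ?_
  refine (norm_powerNonlinearity_sub_le hα.le ((norm_apply_le v x).trans hv)
    ((norm_apply_le w x).trans hw)).trans ?_
  gcongr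
  exact norm_apply_le (v - w) x

theorem isMildPair_heatOp {α : ℝ} (hα : 0 < α) (lam : ℂ) :
    IsMildPair (heatOp (N := N)) fun v => lam • powerC₀ α hα v where
  continuous_apply := continuous_heatOp
  norm_le_one := norm_heatOp_le_one
  lipschitzOnWith R := by
    refine ⟨‖lam‖₊ * Real.toNNReal ((2 + α) * R ^ α), .of_dist_le_mul fun v hv w hw => ?_⟩
    rw [mem_closedBall_zero_iff] at hv hw
    have hR := (norm_nonneg v).trans hv
    rw [NNReal.coe_mul, coe_nnnorm, Real.coe_toNNReal _ (by positivity), dist_eq_norm,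
      dist_eq_norm, mul_assoc]
    refine norm_le_of_forall (by positivity) fun x => ?_
    calc ‖lam * powerC₀ α hα v x - lam * powerC₀ α hα w x‖
        = ‖lam‖ * ‖(powerC₀ α hα v - powerC₀ α hα w) x‖ := by
          rw [← mul_sub, norm_mul, ZeroAtInftyContinuousMap.sub_apply]
      _ ≤ ‖lam‖ * ((2 + α) * R ^ α * ‖v - w‖) := by
          gcongr
          exact (norm_apply_le _ x).trans (norm_powerC₀_sub_le hα hv hw)

theorem heatOp_smul_apply (t : ℝ) (lam : ℂ) (v : C₀(𝔼, ℂ)) (x : 𝔼) :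
    heatOp t (lam • v) x = lam * heatOp t v x := by
  simp only [heatOp_apply, ZeroAtInftyContinuousMap.smul_apply, ← integral_const_mul, smul_eq_mul,
    mul_smul_comm]

theorem mildMap_heatOp_apply {α : ℝ} (hα : 0 < α) (lam : ℂ) (φ : C₀(𝔼, ℂ)) {u : ℝ → C₀(𝔼, ℂ)}
    {t : ℝ} (ht : 0 ≤ t) (hu : ContinuousOn u (Icc 0 t)) (x : 𝔼) :
    mildMap heatOp (fun v => lam • powerC₀ α hα v) φ u t x = heatSemigroup t φ x +
      lam * ∫ s in (0 : ℝ)..t,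
        heatSemigroup (t - s) (fun y => powerNonlinearity α (u s y)) x := by
  rw [mildMap, ZeroAtInftyContinuousMap.add_apply, heatSemigroup_eq_heatOp,
    ← intervalIntegral.integral_const_mul, ← evalCLM_apply x (∫ s in (0 : ℝ)..t, _),
    ← ContinuousLinearMap.intervalIntegral_comp_comm _
    ((isMildPair_heatOp hα lam).intervalIntegrable_integrand ht hu)]
  congr 1
  refine intervalIntegral.integral_congr fun s _ => ?_
  simp only [evalCLM_apply, heatOp_smul_apply]
  exact congrArg _ (heatSemigroup_eq_heatOp (t - s) (powerC₀ α hα (u s)) x).symm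

theorem Icc_subset_setOf_lt {T : EReal} {t : ℝ} (ht : (t : EReal) < T) :
    Icc 0 t ⊆ {s : ℝ | 0 ≤ s ∧ (s : EReal) < T} :=
  fun _ hs => ⟨hs.1, (EReal.coe_le_coe_iff.2 hs.2).trans_lt ht⟩

section

variable {α : ℝ} {lam : ℂ} {φ : C₀(EuclideanSpace ℝ (Fin N), ℂ)} {T : EReal}
  {u : ℝ → C₀(EuclideanSpace ℝ (Fin N), ℂ)}

theorem isSolution_iff (hα : 0 < α) :
    IsSolution α lam φ T u ↔ ContinuousOn u {t : ℝ | 0 ≤ t ∧ (t : EReal) < T} ∧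
      ∀ t : ℝ, 0 ≤ t → (t : EReal) < T →
        u t = mildMap heatOp (fun v => lam • powerC₀ α hα v) φ u t := by
  refine ⟨fun h => ⟨h.continuousOn, fun t ht hT => ?_⟩, fun h => ⟨h.1, fun t ht hT x => ?_⟩⟩
  · ext x
    rw [mildMap_heatOp_apply hα lam φ ht (h.continuousOn.mono (Icc_subset_setOf_lt hT))]
    exact h.duhamel t ht hT x
  · rw [h.2 t ht hT, mildMap_heatOp_apply hα lam φ ht (h.1.mono (Icc_subset_setOf_lt hT))]

theorem IsSolution.eq_of_lt (hα : 0 < α) {T' : EReal} {v : ℝ → C₀(𝔼, ℂ)}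
    (hu : IsSolution α lam φ T u) (hv : IsSolution α lam φ T' v) {t : ℝ} (ht : 0 ≤ t)
    (hT : (t : EReal) < T) (hT' : (t : EReal) < T') : u t = v t := by
  rw [isSolution_iff hα] at hu hv
  have h_sub := Icc_subset_setOf_lt hT
  have h_sub' := Icc_subset_setOf_lt hT'
  exact (isMildPair_heatOp hα lam).eqOn_of_mildMap (hu.1.mono h_sub) (hv.1.mono h_sub')
    (fun s hs => hu.2 s hs.1 (h_sub hs).2) (fun s hs => hv.2 s hs.1 (h_sub' hs).2) ⟨ht, le_rfl⟩

theorem exists_isSolution (hα : 0 < α) (lam : ℂ) (φ : C₀(𝔼, ℂ)) :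
    ∃ T : EReal, 0 < T ∧ ∃ u : ℝ → C₀(𝔼, ℂ), IsSolution α lam φ T u := by
  obtain ⟨τ, hτ, u, hu, hu'⟩ := (isMildPair_heatOp hα lam).exists_local_solution φ
  exact ⟨τ, EReal.coe_pos.2 hτ, u, (isSolution_iff hα).2
    ⟨hu.continuousOn, fun t ht hT => hu' t ⟨ht, (EReal.coe_lt_coe_iff.1 hT).le⟩⟩⟩

theorem IsSolution.of_forall_exists
    (h : ∀ t : ℝ, 0 ≤ t → (t : EReal) < T → ∃ T' v, (t : EReal) < T' ∧ IsSolution α lam φ T' v ∧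
      ∀ s : ℝ, 0 ≤ s → (s : EReal) < T' → u s = v s) : IsSolution α lam φ T u where
  continuousOn := by
    rintro t ⟨ht, hT⟩
    obtain ⟨T', v, hT', hv, huv⟩ := h t ht hT
    have h_nhds : {s : ℝ | (s : EReal) < T'} ∈ 𝓝 t :=
      (isOpen_lt continuous_coe_real_ereal continuous_const).mem_nhds hT'
    refine ((hv.continuousOn t ⟨ht, hT'⟩).congr (fun s hs => huv s hs.1 hs.2)
      (huv t ht hT')).mono_of_mem_nhdsWithin ?_
    filter_upwards [mem_nhdsWithin_of_mem_nhds h_nhds, self_mem_nhdsWithin] with s hs hs'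
    exact ⟨hs'.1, hs⟩
  duhamel t ht hT x := by
    obtain ⟨T', v, hT', hv, huv⟩ := h t ht hT
    rw [huv t ht hT', hv.duhamel t ht hT' x]
    congr 2
    refine intervalIntegral.integral_congr fun s hs => ?_
    rw [uIcc_of_le ht] at hs
    rw [huv s hs.1 (Icc_subset_setOf_lt hT' hs).2]

theorem exists_isMaximalSolution (hα : 0 < α) (lam : ℂ) (φ : C₀(𝔼, ℂ)) :
    ∃ (T : EReal) (u : ℝ → C₀(𝔼, ℂ)), IsMaximalSolution α lam φ T u := by
  classical
  let u : ℝ → C₀(𝔼, ℂ) := fun t =>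
    if h : ∃ v : ℝ → C₀(𝔼, ℂ), ∃ T', IsSolution α lam φ T' v ∧ (t : EReal) < T'
    then h.choose t else 0
  have hu : ∀ (T' : EReal) (v : ℝ → C₀(𝔼, ℂ)), IsSolution α lam φ T' v →
      ∀ t : ℝ, 0 ≤ t → (t : EReal) < T' → u t = v t := by
    intro T' v hv t ht hT'
    have h : ∃ v : ℝ → C₀(𝔼, ℂ), ∃ T', IsSolution α lam φ T' v ∧ (t : EReal) < T' :=
      ⟨v, T', hv, hT'⟩
    obtain ⟨T₁, h₁, hT₁⟩ := h.choose_spec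
    rw [show u t = h.choose t from dif_pos h]
    exact h₁.eq_of_lt hα hv ht hT₁ hT'
  obtain ⟨τ, hτ, w, hw⟩ := exists_isSolution hα lam φ
  refine ⟨sSup {T' | ∃ v : ℝ → C₀(𝔼, ℂ), IsSolution α lam φ T' v}, u,
    hτ.trans_le (le_sSup ⟨w, hw⟩), .of_forall_exists fun t _ hT => ?_,
    fun T' v hv => ⟨le_sSup ⟨v, hv⟩, fun t ht hT' => (hu T' v hv t ht hT').symm⟩⟩
  obtain ⟨T', ⟨v, hv⟩, hT'⟩ := lt_sSup_iff.1 hT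
  exact ⟨T', v, hT', hv, hu T' v hv⟩

end

/-! ### Test functions against Bessel potential spaces -/

theorem fourierInv_testSchwartz (i : Fin N) (c : Fin N → ℝ) (hc : ∀ i, 0 < c i) (ξ : 𝔼) :
    𝓕⁻ (testSchwartz i c hc) ξ = -((2 * Real.pi * Complex.I * ξ i) ^ 5 *
      ((Real.exp (-(4 * Real.pi ^ 2 * ∑ i, c i * ξ i ^ 2)) : ℝ) : ℂ)) := by
  have h : 𝓕⁻ (testSchwartz i c hc) ξ = 𝓕 (testSchwartz i c hc) (-ξ) := by
    rw [SchwartzMap.fourierInv_coe, SchwartzMap.fourier_coe, Real.fourierInv_eq_fourier_neg]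
  rw [h, fourier_testSchwartz]
  simp only [PiLp.neg_apply, neg_sq, Complex.ofReal_neg]
  ring

theorem exp_mul_fourierInv_testSchwartz (i : Fin N) (c : Fin N → ℝ) (hc : ∀ i, 0 < c i) {r : ℝ}
    (hc' : ∀ j, 0 < c j + r / (4 * Real.pi ^ 2)) (ξ : 𝔼) :
    ((Real.exp (-(r * ‖ξ‖ ^ 2)) : ℝ) : ℂ) * 𝓕⁻ (testSchwartz i c hc) ξ =
      𝓕⁻ (testSchwartz i (fun j => c j + r / (4 * Real.pi ^ 2)) hc') ξ := by
  rw [fourierInv_testSchwartz, fourierInv_testSchwartz, mul_neg, mul_left_comm,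
    ← Complex.ofReal_mul, ← Real.exp_add]
  congr 5
  simp only [add_mul, Finset.sum_add_distrib]
  rw [← Finset.mul_sum, ← EuclideanSpace.real_norm_sq_eq]
  field_simp
  ring

theorem rpow_neg_eq_integral {s y : ℝ} (hs : 0 < s) (hy : 0 < y) :
    y ^ (-s) = (Real.Gamma s)⁻¹ *
      ∫ r in Ioi (0 : ℝ), r ^ (s - 1) * Real.exp (-(y * r)) := by
  rw [Real.integral_rpow_mul_exp_neg_mul_Ioi hs hy, mul_comm ((1 / y) ^ s),
    inv_mul_cancel_left₀ (Real.Gamma_pos_of_pos hs).ne', one_div, Real.inv_rpow hy.le,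
    ← Real.rpow_neg hy.le]

section Subordination

variable {V : Type*} [NormedAddCommGroup V] [InnerProductSpace ℝ V] [FiniteDimensional ℝ V]
  [MeasurableSpace V] [BorelSpace V]

theorem integrable_gamma_mul_exp_mul {s : ℝ} (hs : 0 < s) (g : 𝓢(V, ℂ)) (x : V) :
    Integrable (fun q : V × ℝ => ((q.2 ^ (s - 1) * Real.exp (-q.2) : ℝ) : ℂ) *
      (Complex.exp (((-2 * Real.pi * inner ℝ q.1 x : ℝ) : ℂ) * Complex.I) *
        (((Real.exp (-(q.2 * ‖q.1‖ ^ 2)) : ℝ) : ℂ) * g q.1)))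
      (volume.prod (volume.restrict (Ioi 0))) := by
  have h_gamma : Integrable (fun r : ℝ => ((r ^ (s - 1) * Real.exp (-r) : ℝ) : ℂ))
      (volume.restrict (Ioi 0)) := by
    refine (Real.GammaIntegral_convergent hs).ofReal (𝕜 := ℂ) |>.congr (.of_forall fun r => ?_)
    simp only [mul_comm]
    rfl
  have h_bdd := ((g.integrable (μ := volume)).mul_prod h_gamma).bdd_mul (c := 1)
    (f := fun q : V × ℝ => Complex.exp (((-2 * Real.pi * inner ℝ q.1 x : ℝ) : ℂ) * Complex.I) *
      ((Real.exp (-(max q.2 0 * ‖q.1‖ ^ 2)) : ℝ) : ℂ))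
    (Continuous.aestronglyMeasurable (by fun_prop)) (.of_forall fun q => by
      rw [norm_mul, Complex.norm_exp_ofReal_mul_I, one_mul, Complex.norm_real,
        Real.norm_of_nonneg (Real.exp_pos _).le, Real.exp_le_one_iff, neg_nonpos]
      positivity)
  have h_pos : ∀ᵐ q : V × ℝ ∂(volume.prod (volume.restrict (Ioi 0))), q.2 ∈ Ioi (0 : ℝ) :=
    Measure.quasiMeasurePreserving_snd.ae (ae_restrict_mem measurableSet_Ioi)
  refine h_bdd.congr ?_
  filter_upwards [h_pos] with q hq
  rw [max_eq_left (le_of_lt hq)]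
  ring

/-- The Bessel potential of order `s` of a Schwartz function, with the normalization of the
Fourier transform used by `TemperedDistribution.besselPotential`. -/
def besselSchwartz (s : ℝ) (g : 𝓢(V, ℂ)) : 𝓢(V, ℂ) :=
  𝓕 (SchwartzMap.smulLeftCLM ℂ (fun ξ : V => (((1 + ‖ξ‖ ^ 2) ^ (-s / 2) : ℝ) : ℂ)) (𝓕⁻ g))

theorem besselSchwartz_apply {s : ℝ} (hs : 0 < s) (g : 𝓢(V, ℂ)) (x : V) :
    besselSchwartz s g x = (((Real.Gamma (s / 2))⁻¹ : ℝ) : ℂ) *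
      ∫ r in Ioi (0 : ℝ), ((r ^ (s / 2 - 1) * Real.exp (-r) : ℝ) : ℂ) *
        𝓕 (fun ξ => ((Real.exp (-(r * ‖ξ‖ ^ 2)) : ℝ) : ℂ) * 𝓕⁻ g ξ) x := by
  have h_growth : (fun ξ : V => (((1 + ‖ξ‖ ^ 2) ^ (-s / 2) : ℝ) : ℂ)).HasTemperateGrowth := by
    fun_prop
  have h_symbol : ∀ ξ : V, (((1 + ‖ξ‖ ^ 2) ^ (-s / 2) : ℝ) : ℂ) =
      (((Real.Gamma (s / 2))⁻¹ : ℝ) : ℂ) * ∫ r in Ioi (0 : ℝ),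
        ((r ^ (s / 2 - 1) * Real.exp (-r) * Real.exp (-(r * ‖ξ‖ ^ 2)) : ℝ) : ℂ) := by
    intro ξ
    rw [neg_div, rpow_neg_eq_integral (half_pos hs) (by positivity), integral_complex_ofReal,
      Complex.ofReal_mul]
    simp only [mul_assoc, ← Real.exp_add]
    ring_nf
  simp only [besselSchwartz, SchwartzMap.fourier_coe, Real.fourier_eq', smul_eq_mul,
    SchwartzMap.smulLeftCLM_apply_apply h_growth]
  calc ∫ ξ, Complex.exp (((-2 * Real.pi * inner ℝ ξ x : ℝ) : ℂ) * Complex.I) *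
        ((((1 + ‖ξ‖ ^ 2) ^ (-s / 2) : ℝ) : ℂ) * 𝓕⁻ g ξ)
      = (((Real.Gamma (s / 2))⁻¹ : ℝ) : ℂ) * ∫ ξ, ∫ r in Ioi (0 : ℝ),
        ((r ^ (s / 2 - 1) * Real.exp (-r) : ℝ) : ℂ) *
          (Complex.exp (((-2 * Real.pi * inner ℝ ξ x : ℝ) : ℂ) * Complex.I) *
            (((Real.exp (-(r * ‖ξ‖ ^ 2)) : ℝ) : ℂ) * 𝓕⁻ g ξ)) := by
        rw [← integral_const_mul]
        refine integral_congr_ae (.of_forall fun ξ => ?_)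
        dsimp only
        rw [h_symbol, mul_left_comm (Complex.exp _), mul_assoc (((Real.Gamma _)⁻¹ : ℝ) : ℂ),
          ← integral_mul_const]
        congr 1
        refine integral_congr_ae (.of_forall fun r => ?_)
        push_cast
        ring
    _ = _ := by
        rw [integral_integral_swap (integrable_gamma_mul_exp_mul (half_pos hs) (𝓕⁻ g) x)]
        simp only [integral_const_mul]

end Subordination

theorem besselSchwartz_testSchwartz (i : Fin N) (c : Fin N → ℝ) (hc : ∀ i, 0 < c i) {s : ℝ}
    (hs : 0 < s) (x : 𝔼) :
    besselSchwartz s (testSchwartz i c hc) x = (((Real.Gamma (s / 2))⁻¹ : ℝ) : ℂ) *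
      ∫ r in Ioi (0 : ℝ), ((r ^ (s / 2 - 1) * Real.exp (-r) : ℝ) : ℂ) *
        (testFun i (fun j => c j + r / (4 * Real.pi ^ 2)) x : ℂ) := by
  rw [besselSchwartz_apply hs]
  congr 1
  refine setIntegral_congr_fun measurableSet_Ioi fun r (hr : 0 < r) => ?_
  have hc' : ∀ j, 0 < c j + r / (4 * Real.pi ^ 2) := fun j => by
    have := hc j
    positivity
  simp only [exp_mul_fourierInv_testSchwartz i c hc hc']
  rw [← SchwartzMap.fourier_coe, FourierTransform.fourier_fourierInv_eq, testSchwartz_apply]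

theorem enorm_besselSchwartz_testSchwartz_le (i : Fin N) (c : Fin N → ℝ) (hc : ∀ i, 0 < c i)
    {s : ℝ} (hs : 0 < s) (x : 𝔼) :
    ‖besselSchwartz s (testSchwartz i c hc) x‖ₑ ≤ ENNReal.ofReal (Real.Gamma (s / 2))⁻¹ *
      ∫⁻ r in Ioi (0 : ℝ), ENNReal.ofReal (r ^ (s / 2 - 1) * Real.exp (-r)) *
        ENNReal.ofReal |testFun i (fun j => c j + r / (4 * Real.pi ^ 2)) x| := by
  have := Real.Gamma_pos_of_pos (half_pos hs)
  rw [besselSchwartz_testSchwartz i c hc hs, enorm_mul, ← ofReal_norm, Complex.norm_real,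
    Real.norm_of_nonneg (by positivity)]
  gcongr
  refine (enorm_integral_le_lintegral_enorm _).trans_eq ?_
  refine setLIntegral_congr_fun measurableSet_Ioi fun r (hr : 0 < r) => ?_
  rw [enorm_mul, ← ofReal_norm, ← ofReal_norm, Complex.norm_real, Complex.norm_real,
    Real.norm_of_nonneg (by positivity), Real.norm_eq_abs]

theorem measurable_testFun_uncurry (i : Fin N) (c : Fin N → ℝ) :
    Measurable fun q : 𝔼 × ℝ => testFun i (fun j => c j + q.2 / (4 * Real.pi ^ 2)) q.1 := by
  unfold testFun fifthDerivGauss gauss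
  fun_prop

theorem rpow_mul_exp_mul_rpow_le {a k r σ q : ℝ} (ha : 0 ≤ a) (hk : 0 < k) (hr : 0 < r)
    (hq : 0 ≤ q) : r ^ (σ - 1) * Real.exp (-r) * (a + r / k) ^ (-q) ≤
      k ^ q * (Real.exp (-r) * r ^ (σ - q - 1)) := by
  calc r ^ (σ - 1) * Real.exp (-r) * (a + r / k) ^ (-q)
      ≤ r ^ (σ - 1) * Real.exp (-r) * (r / k) ^ (-q) := by
        gcongr ?_ * ?_
        exact Real.rpow_le_rpow_of_nonpos (by positivity) (by linarith) (by linarith)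
    _ = k ^ q * (Real.exp (-r) * (r ^ (σ - 1) * r ^ (-q))) := by
        rw [Real.div_rpow hr.le hk.le, Real.rpow_neg hk.le, div_inv_eq_mul]
        ring
    _ = k ^ q * (Real.exp (-r) * r ^ (σ - q - 1)) := by
        rw [← Real.rpow_add hr]
        ring_nf

theorem lintegral_exp_mul_rpow_lt_top {σ : ℝ} (hσ : 0 < σ) :
    ∫⁻ r in Ioi (0 : ℝ), ENNReal.ofReal (Real.exp (-r) * r ^ (σ - 1)) < ⊤ :=
  (Real.GammaIntegral_convergent hσ).lintegral_lt_top

theorem lintegral_mul_besselSchwartz_testSchwartz_le (i : Fin N) (c : Fin N → ℝ)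
    (hc : ∀ i, 0 < c i) {s : ℝ} (hs : 0 < s) {w : 𝔼 → ℝ≥0∞} (hw : Measurable w) :
    ∫⁻ x, w x * ‖besselSchwartz s (testSchwartz i c hc) x‖ₑ ≤
      ENNReal.ofReal (Real.Gamma (s / 2))⁻¹ *
        ∫⁻ r in Ioi (0 : ℝ), ENNReal.ofReal (r ^ (s / 2 - 1) * Real.exp (-r)) *
          ∫⁻ x, w x * ENNReal.ofReal |testFun i (fun j => c j + r / (4 * Real.pi ^ 2)) x| := by
  have h_meas := measurable_testFun_uncurry i c
  have h_meas_left : ∀ r, Measurable fun x : 𝔼 => w x *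
      ENNReal.ofReal |testFun i (fun j => c j + r / (4 * Real.pi ^ 2)) x| := fun r =>
    hw.mul (h_meas.comp measurable_prodMk_right).abs.ennreal_ofReal
  have h_meas_right : ∀ x : 𝔼, Measurable fun r =>
      ENNReal.ofReal (r ^ (s / 2 - 1) * Real.exp (-r)) *
        ENNReal.ofReal |testFun i (fun j => c j + r / (4 * Real.pi ^ 2)) x| := fun x =>
    Measurable.mul (by fun_prop) (h_meas.comp measurable_prodMk_left).abs.ennreal_ofReal
  simp only [← lintegral_const_mul _ (h_meas_left _)]
  rw [← lintegral_lintegral_swap, ← lintegral_const_mul' _ _ ENNReal.ofReal_ne_top]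
  · refine lintegral_mono fun x => ?_
    refine (mul_le_mul_right (enorm_besselSchwartz_testSchwartz_le i c hc hs x) _).trans_eq ?_
    rw [mul_left_comm, ← lintegral_const_mul _ (h_meas_right x)]
    simp only [mul_left_comm]
  · refine Measurable.aemeasurable ?_
    simp only [Function.uncurry_def]
    fun_prop

theorem exists_lintegral_mul_besselSchwartz_testSchwartz_le {p s : ℝ} (hp : 1 < p)
    (hs : 5 + 1 / p < s) : ∃ C : ℝ≥0∞, C < ⊤ ∧
    ∀ (i : Fin N) (c : Fin N → ℝ) (hi : 0 < c i) (hc : ∀ j, j ≠ i → 1 ≤ c j),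
      ∀ w : 𝔼 → ℝ≥0∞, Measurable w →
        ∫⁻ x, w x * ‖besselSchwartz s (testSchwartz i c (pos_of_pos_of_one_le hi hc)) x‖ₑ ≤
          (∫⁻ x, w x ^ p) ^ (1 / p) * C := by
  obtain ⟨C, hC, h_le⟩ := exists_lintegral_mul_testFun_le (N := N) hp
  have hp₀ : 0 < 1 / p := by positivity
  let q : ℝ := 5 / 2 + 1 / (2 * p)
  have hq : s / 2 - q = (s - (5 + 1 / p)) / 2 := by
    simp only [q]
    ring
  let k : ℝ := 4 * Real.pi ^ 2
  let G : ℝ → ℝ≥0∞ := fun r => ENNReal.ofReal (Real.exp (-r) * r ^ (s / 2 - q - 1))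
  have hG : ∫⁻ r in Ioi (0 : ℝ), G r < ⊤ := lintegral_exp_mul_rpow_lt_top (by linarith)
  refine ⟨ENNReal.ofReal (Real.Gamma (s / 2))⁻¹ *
    (ENNReal.ofReal (C * k ^ q) * ∫⁻ r in Ioi (0 : ℝ), G r),
    ENNReal.mul_lt_top ENNReal.ofReal_lt_top (ENNReal.mul_lt_top ENNReal.ofReal_lt_top hG),
    fun i c hi hc w hw => ?_⟩
  have h_slice : ∀ r ∈ Ioi (0 : ℝ), ENNReal.ofReal (r ^ (s / 2 - 1) * Real.exp (-r)) *
      ∫⁻ x, w x * ENNReal.ofReal |testFun i (fun j => c j + r / k) x| ≤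
        (∫⁻ x, w x ^ p) ^ (1 / p) * (ENNReal.ofReal (C * k ^ q) * G r) := by
    intro r (hr : 0 < r)
    have hrk : 0 < r / k := by positivity
    refine (mul_le_mul_right (h_le i (fun j => c j + r / k) (by positivity)
      (fun j hj => le_add_of_le_of_nonneg (hc j hj) hrk.le) w hw.aemeasurable) _).trans ?_
    rw [mul_left_comm, ← ENNReal.ofReal_mul (by positivity), ← ENNReal.ofReal_mul (by positivity)]
    refine mul_le_mul_right (ENNReal.ofReal_le_ofReal ?_) _
    rw [mul_left_comm, mul_assoc C, ← neg_add']
    refine mul_le_mul_of_nonneg_left ?_ hC.le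
    exact rpow_mul_exp_mul_rpow_le hi.le (by positivity) hr (by positivity)
  calc ∫⁻ x, w x * ‖besselSchwartz s (testSchwartz i c (pos_of_pos_of_one_le hi hc)) x‖ₑ
      ≤ ENNReal.ofReal (Real.Gamma (s / 2))⁻¹ *
          ∫⁻ r in Ioi (0 : ℝ), ENNReal.ofReal (r ^ (s / 2 - 1) * Real.exp (-r)) *
            ∫⁻ x, w x * ENNReal.ofReal |testFun i (fun j => c j + r / k) x| :=
        lintegral_mul_besselSchwartz_testSchwartz_le i c _ (by linarith) hw
    _ ≤ ENNReal.ofReal (Real.Gamma (s / 2))⁻¹ * ∫⁻ r in Ioi (0 : ℝ),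
          (∫⁻ x, w x ^ p) ^ (1 / p) * (ENNReal.ofReal (C * k ^ q) * G r) :=
        mul_le_mul_right (setLIntegral_mono' measurableSet_Ioi h_slice) _
    _ = (∫⁻ x, w x ^ p) ^ (1 / p) * (ENNReal.ofReal (Real.Gamma (s / 2))⁻¹ *
          (ENNReal.ofReal (C * k ^ q) * ∫⁻ r in Ioi (0 : ℝ), G r)) := by
        have hG_meas : Measurable G := by fun_prop
        rw [lintegral_const_mul _ (hG_meas.const_mul _), lintegral_const_mul _ hG_meas,
          mul_left_comm]

theorem exists_norm_integral_testFun_le_of_memHsp {s : ℝ} {p : ℝ≥0∞} [Fact (1 ≤ p)] (hp : 1 < p)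
    (hp' : p < ⊤) (hs : 5 + 1 / p.toReal < s) {v : C₀(𝔼, ℂ)} (hv : MemHsp s p v) (i : Fin N) :
    ∃ B : ℝ, ∀ c : Fin N → ℝ, 0 < c i → (∀ j, j ≠ i → 1 ≤ c j) →
      ‖∫ x, testFun i c x • v x‖ ≤ B := by
  obtain ⟨w, hw⟩ := hv
  rw [← TemperedDistribution.besselPotential_neg_apply_eq_iff] at hw
  have hp_real : 1 < p.toReal := by
    rw [← ENNReal.toReal_one]
    exact (ENNReal.toReal_lt_toReal ENNReal.one_ne_top hp'.ne).2 hp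
  obtain ⟨C, hC, h_le⟩ := exists_lintegral_mul_besselSchwartz_testSchwartz_le (N := N) hp_real hs
  have hw_top : (∫⁻ x, ‖w x‖ₑ ^ p.toReal) ^ (1 / p.toReal) < ⊤ := by
    rw [← eLpNorm_eq_lintegral_rpow_enorm_toReal (by positivity) hp'.ne]
    exact (Lp.memLp w).2
  refine ⟨((∫⁻ x, ‖w x‖ₑ ^ p.toReal) ^ (1 / p.toReal) * C).toReal, fun c hi hc => ?_⟩
  have h_pos := pos_of_pos_of_one_le hi hc
  have h_pair : ∫ x, testFun i c x • v x =
      ∫ x, besselSchwartz s (testSchwartz i c h_pos) x • w x := by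
    calc ∫ x, testFun i c x • v x
        = toDistribution v (testSchwartz i c h_pos) := by
          simp only [toDistribution_apply, testSchwartz_apply, Complex.real_smul]
      _ = ∫ x, besselSchwartz s (testSchwartz i c h_pos) x • w x := by
          rw [← hw, TemperedDistribution.besselPotential,
            TemperedDistribution.fourierMultiplierCLM_apply_apply, Lp.toTemperedDistribution_apply]
          rfl
  rw [h_pair, ← toReal_enorm]
  refine ENNReal.toReal_mono (ENNReal.mul_lt_top hw_top hC).ne
    ((enorm_integral_le_lintegral_enorm _).trans ?_)
  simp only [enorm_smul, mul_comm ‖besselSchwartz _ _ _‖ₑ]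
  exact h_le i c hi hc _ (Lp.stronglyMeasurable w).measurable.enorm

/-! ### Odd solutions near the hyperplane of antisymmetry -/

theorem gauss_le_gauss {a : ℝ} (ha : 0 < a) {x y : ℝ} (h : x ^ 2 ≤ y ^ 2) :
    gauss a y ≤ gauss a x := by
  unfold gauss
  gcongr

theorem abs_gauss_sub_sub_gauss_neg_sub {a x : ℝ} (ha : 0 < a) (hx : 0 ≤ x) (y : ℝ) :
    |gauss a (x - y) - gauss a (-x - y)| = gauss a (|y| - x) - gauss a (|y| + x) := by
  wlog hy : 0 ≤ y generalizing y
  · rw [← abs_neg y, ← this (-y) (by linarith), abs_sub_comm, ← gauss_neg a (x - y),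
      ← gauss_neg a (-x - y)]
    ring_nf
  have h_mono : gauss a (y + x) ≤ gauss a (y - x) := gauss_le_gauss ha (by nlinarith)
  rw [abs_of_nonneg hy, ← neg_sub y x, gauss_neg, show -x - y = -(y + x) by ring, gauss_neg,
    abs_of_nonneg (sub_nonneg.2 h_mono)]

theorem integral_abs_gauss_sub_le {a : ℝ} (ha : 0 < a) (x : ℝ) :
    ∫ y, |gauss a (x - y) - gauss a (-x - y)| ≤ 4 * |x| * (√a)⁻¹ := by
  wlog hx : 0 ≤ x generalizing x
  · simpa only [neg_neg, abs_neg, abs_sub_comm] using this (-x) (by linarith)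
  have h_int := integrable_gauss ha
  have h_shift_right : ∫ y in Ioi (0 : ℝ), gauss a (y - x) = ∫ y in Ioi (-x), gauss a y := by
    simpa using (measurePreserving_sub_right volume x).setIntegral_preimage_emb
      (measurableEmbedding_subRight x) (gauss a) (Ioi (-x))
  have h_shift_left : ∫ y in Ioi (0 : ℝ), gauss a (y + x) = ∫ y in Ioi x, gauss a y := by
    simpa using (measurePreserving_add_right volume x).setIntegral_preimage_emb
      (measurableEmbedding_addRight x) (gauss a) (Ioi x)
  have h_le : ∫ y in (-x)..x, gauss a y ≤ ∫ _ in (-x)..x, (√a)⁻¹ :=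
    intervalIntegral.integral_mono_on (by linarith) h_int.intervalIntegrable
      intervalIntegrable_const fun y _ => gauss_le ha y
  rw [intervalIntegral.integral_const, smul_eq_mul] at h_le
  simp only [abs_gauss_sub_sub_gauss_neg_sub ha hx]
  rw [integral_comp_abs (f := fun r => gauss a (r - x) - gauss a (r + x)),
    integral_sub (h_int.comp_sub_right x).integrableOn (h_int.comp_add_right x).integrableOn,
    h_shift_right, h_shift_left,
    intervalIntegral.integral_Ioi_sub_Ioi h_int.integrableOn (by linarith), abs_of_nonneg hx]
  linarith

/-- Reflection in the hyperplane `x i = 0`. -/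
def reflect (i : Fin N) : 𝔼 ≃ₗᵢ[ℝ] 𝔼 :=
  LinearIsometryEquiv.piLpCongrRight 2 fun j =>
    if j = i then LinearIsometryEquiv.neg ℝ else LinearIsometryEquiv.refl ℝ ℝ

theorem reflect_apply (i : Fin N) (x : 𝔼) (j : Fin N) :
    reflect i x j = if j = i then -x j else x j := by
  rw [reflect, LinearIsometryEquiv.piLpCongrRight_apply]
  split_ifs with h <;> simp [h]

theorem reflect_reflect (i : Fin N) (x : 𝔼) : reflect i (reflect i x) = x := by
  ext j
  simp only [reflect_apply]
  split_ifs <;> simp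

theorem norm_sub_reflect (i : Fin N) (x : 𝔼) : ‖x - reflect i x‖ = 2 * |x i| := by
  have h_single : x - reflect i x = EuclideanSpace.single i (2 * x i) := by
    ext j
    rw [PiLp.sub_apply, reflect_apply, PiLp.single_apply]
    split_ifs with h
    · rw [h]
      ring
    · ring
  rw [h_single, PiLp.norm_single, Real.norm_eq_abs, abs_mul, abs_two]

theorem gaussProd_reflect (i : Fin N) (c : Fin N → ℝ) (x : 𝔼) :
    gaussProd c (reflect i x) = gaussProd c x := by
  refine Finset.prod_congr rfl fun j _ => ?_
  rw [reflect_apply]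
  split_ifs
  · rw [gauss_neg]
  · rfl

/-- The odd reflection `v ↦ -(v ∘ reflect i)` on `C₀`; its fixed points are the functions which are
odd in the coordinate `x i`. -/
def oddReflect (i : Fin N) : C₀(𝔼, ℂ) →L[ℂ] C₀(𝔼, ℂ) :=
  LinearMap.mkContinuous
    ⟨⟨fun v => -(v.comp (reflect i).toHomeomorph.toCocompactMap), fun v w => by
      ext x
      exact neg_add (v _) (w _)⟩, fun c v => by
      ext x
      exact (mul_neg c (v _)).symm⟩ 1
    fun v => by
      rw [one_mul]
      exact norm_le_of_forall (norm_nonneg v) fun x =>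
        (norm_neg _).trans_le (norm_apply_le v (reflect i x))

theorem oddReflect_apply (i : Fin N) (v : C₀(𝔼, ℂ)) (x : 𝔼) :
    oddReflect i v x = -v (reflect i x) := rfl

theorem heatOp_oddReflect (i : Fin N) (t : ℝ) (v : C₀(𝔼, ℂ)) :
    heatOp t (oddReflect i v) = oddReflect i (heatOp t v) := by
  ext x
  rw [oddReflect_apply, heatOp_apply, heatOp_apply, ← integral_neg,
    ← (reflect i).measurePreserving.integral_comp (reflect i).toHomeomorph.measurableEmbedding]
  refine integral_congr_ae (.of_forall fun z => ?_)
  dsimp only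
  rw [gaussProd_reflect, oddReflect_apply, map_sub, map_smul, reflect_reflect, smul_neg]

theorem powerNonlinearity_neg (α : ℝ) (z : ℂ) :
    powerNonlinearity α (-z) = -powerNonlinearity α z := by
  simp [powerNonlinearity]

theorem powerC₀_oddReflect (i : Fin N) {α : ℝ} (hα : 0 < α) (v : C₀(𝔼, ℂ)) :
    powerC₀ α hα (oddReflect i v) = oddReflect i (powerC₀ α hα v) := by
  ext x
  simp only [powerC₀_apply, oddReflect_apply, powerNonlinearity_neg]

theorem mildMap_oddReflect (i : Fin N) {α : ℝ} (hα : 0 < α) (lam : ℂ) (φ : C₀(𝔼, ℂ))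
    {u : ℝ → C₀(𝔼, ℂ)} {t : ℝ} (ht : 0 ≤ t) (hu : ContinuousOn u (Icc 0 t)) :
    mildMap heatOp (fun v => lam • powerC₀ α hα v) (oddReflect i φ)
        (fun s => oddReflect i (u s)) t =
      oddReflect i (mildMap heatOp (fun v => lam • powerC₀ α hα v) φ u t) := by
  rw [mildMap, mildMap, map_add, ← ContinuousLinearMap.intervalIntegral_comp_comm _
    ((isMildPair_heatOp hα lam).intervalIntegrable_integrand ht hu)]
  simp only [powerC₀_oddReflect, ← map_smul, heatOp_oddReflect]

theorem IsSolution.oddReflect_eq (i : Fin N) {α : ℝ} (hα : 0 < α) {lam : ℂ} {φ : C₀(𝔼, ℂ)}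
    {T : EReal} {u : ℝ → C₀(𝔼, ℂ)} (hu : IsSolution α lam φ T u) (hφ : oddReflect i φ = φ)
    {t : ℝ} (ht : 0 ≤ t) (hT : (t : EReal) < T) : oddReflect i (u t) = u t := by
  have hu' := (isSolution_iff hα).1 hu
  have h_reflected : IsSolution α lam φ T fun s => oddReflect i (u s) :=
    (isSolution_iff hα).2 ⟨(oddReflect i).continuous.comp_continuousOn hu'.1, fun t ht hT => by
      have h := mildMap_oddReflect i hα lam φ ht (hu'.1.mono (Icc_subset_setOf_lt hT))
      rwa [hφ, ← hu'.2 t ht hT, eq_comm] at h⟩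
  exact h_reflected.eq_of_lt hα hu ht hT hT

theorem two_mul_norm_eq_of_oddReflect {i : Fin N} {v : C₀(𝔼, ℂ)} (hv : oddReflect i v = v)
    (x : 𝔼) : 2 * ‖v x‖ = ‖v x - v (reflect i x)‖ := by
  have h_odd : v (reflect i x) = -v x := by
    conv_rhs => rw [← hv]
    rw [oddReflect_apply, neg_neg]
  rw [h_odd, sub_neg_eq_add, ← two_mul, norm_mul, Complex.norm_ofNat]

theorem abs_gaussProd_sub_gaussProd_reflect (i : Fin N) (c : Fin N → ℝ) (x y : 𝔼) :
    |gaussProd c (x - y) - gaussProd c (reflect i x - y)| =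
      |gauss (c i) (x i - y i) - gauss (c i) (-x i - y i)| *
        ∏ j ∈ Finset.univ.erase i, gauss (c j) (x j - y j) := by
  have h_erase : ∏ j ∈ Finset.univ.erase i, gauss (c j) ((reflect i x - y) j) =
      ∏ j ∈ Finset.univ.erase i, gauss (c j) ((x - y) j) :=
    Finset.prod_congr rfl fun j hj => by
      rw [PiLp.sub_apply, reflect_apply, if_neg (Finset.ne_of_mem_erase hj), PiLp.sub_apply]
  rw [gaussProd_eq_mul i, gaussProd_eq_mul i, h_erase, ← sub_mul, abs_mul,
    abs_of_nonneg (a := Finset.prod _ _) (Finset.prod_nonneg fun _ _ => gauss_nonneg _ _)]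
  simp only [PiLp.sub_apply, reflect_apply, if_true]

theorem integral_abs_gaussProd_sub_reflect_le (i : Fin N) {c : Fin N → ℝ} (hc : ∀ j, 0 < c j)
    (x : 𝔼) :
    ∫ y, |gaussProd c (x - y) - gaussProd c (reflect i x - y)| ≤ 4 * |x i| * (√(c i))⁻¹ := by
  simp only [abs_gaussProd_sub_gaussProd_reflect]
  rw [integral_mul_prod_erase i (fun r => |gauss (c i) (x i - r) - gauss (c i) (-x i - r)|)
    fun j r => gauss (c j) (x j - r)]
  simp only [integral_sub_left_eq_self (gauss _), integral_gauss (hc _), Finset.prod_const_one,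
    mul_one]
  exact integral_abs_gauss_sub_le (hc i) (x i)

theorem norm_heatOp_sub_reflect_le (i : Fin N) {t : ℝ} (ht : 0 < t) (v : C₀(𝔼, ℂ)) (x : 𝔼) :
    ‖heatOp t v x - heatOp t v (reflect i x)‖ ≤ 4 * |x i| * (√t)⁻¹ * ‖v‖ := by
  have h_int : ∀ x : 𝔼, Integrable fun y : 𝔼 => gaussProd (fun _ => t) (x - y) :=
    (integrable_gaussProd fun _ => ht).comp_sub_left
  calc ‖heatOp t v x - heatOp t v (reflect i x)‖
      = ‖∫ y, (gaussProd (fun _ => t) (x - y) - gaussProd (fun _ => t) (reflect i x - y)) •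
          v y‖ := by
        simp only [sub_smul]
        rw [← heatSemigroup_eq_heatOp, ← heatSemigroup_eq_heatOp, heatSemigroup_eq ht,
          heatSemigroup_eq ht, integral_sub (integrable_smul_apply (h_int _) v)
          (integrable_smul_apply (h_int _) v)]
    _ ≤ ∫ y, |gaussProd (fun _ => t) (x - y) - gaussProd (fun _ => t) (reflect i x - y)| * ‖v‖ := by
        refine norm_integral_le_of_norm_le (((h_int x).sub (h_int (reflect i x))).norm.mul_const _)
          (.of_forall fun y => ?_)
        rw [norm_smul, Real.norm_eq_abs]
        gcongr
        exact norm_apply_le v y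
    _ ≤ 4 * |x i| * (√t)⁻¹ * ‖v‖ := by
        rw [integral_mul_const]
        gcongr
        exact integral_abs_gaussProd_sub_reflect_le i (fun _ => ht) x

theorem exists_norm_sub_sub_le {f : 𝔼 → ℂ} (hf : ContDiff ℝ 2 f) (hfc : HasCompactSupport f) :
    ∃ L : ℝ, ∀ x y k : 𝔼,
      ‖(f (x - k) - f x) - (f (y - k) - f y)‖ ≤ L * ‖k‖ * ‖x - y‖ := by
  obtain ⟨L, hL⟩ := ContDiff.lipschitzWith_of_hasCompactSupport (𝕂 := ℝ) (n := 1)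
    (hfc.fderiv (𝕜 := ℝ)) (hf.fderiv_right (by norm_num)) one_ne_zero
  have h_diff : Differentiable ℝ f := hf.differentiable two_ne_zero
  refine ⟨L, fun x y k => ?_⟩
  refine Convex.norm_image_sub_le_of_norm_hasFDerivWithin_le
    (f := fun x => f (x - k) - f x) (f' := fun x => fderiv ℝ f (x - k) - fderiv ℝ f x)
    (fun z _ => ?_) (fun z _ => ?_) convex_univ (mem_univ y) (mem_univ x)
  · refine (HasFDerivAt.sub ?_ (h_diff z).hasFDerivAt).hasFDerivWithinAt
    have h_shift := (h_diff (z - k)).hasFDerivAt.comp z ((hasFDerivAt_id z).sub_const k)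
    simpa using! h_shift
  · simpa [dist_eq_norm] using hL.dist_le_mul (z - k) z

theorem integrable_gaussProd_mul_norm {c : Fin N → ℝ} (hc : ∀ j, 0 < c j) :
    Integrable fun z : 𝔼 => gaussProd c z * ‖z‖ := by
  refine ((gaussSchwartz c hc).integrable_pow_mul volume 1).congr (.of_forall fun z => ?_)
  simp only [pow_one, gaussSchwartz_apply, Complex.norm_real]
  rw [Real.norm_of_nonneg (gaussProd_nonneg _ _), mul_comm]

theorem integrable_gaussProd_smul_apply_sub (t : ℝ) (v : C₀(𝔼, ℂ)) (x : 𝔼) :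
    Integrable fun z : 𝔼 => gaussProd (fun _ => 1) z • v (x - √t • z) :=
  (evalCLM x).integrable_comp (integrable_gaussProd_smul_translate t v)

theorem integrable_gaussProd_smul_sub (t : ℝ) (v : C₀(𝔼, ℂ)) (x : 𝔼) :
    Integrable fun z : 𝔼 => gaussProd (fun _ => 1) z • (v (x - √t • z) - v x) := by
  simp only [smul_sub]
  exact (integrable_gaussProd_smul_apply_sub t v x).sub
    ((integrable_gaussProd fun _ => one_pos).smul_const _)

theorem heatOp_sub_self_apply (t : ℝ) (v : C₀(𝔼, ℂ)) (x : 𝔼) :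
    (heatOp t v - v) x = ∫ z : 𝔼, gaussProd (fun _ => 1) z • (v (x - √t • z) - v x) := by
  simp only [smul_sub]
  rw [integral_sub (integrable_gaussProd_smul_apply_sub t v x)
    ((integrable_gaussProd fun _ => one_pos).smul_const _), integral_smul_const,
    integral_gaussProd fun _ => one_pos, one_smul, ZeroAtInftyContinuousMap.sub_apply,
    heatOp_apply]

theorem exists_norm_heatOp_sub_self_sub_reflect_le {φ : C₀(𝔼, ℂ)} (hφ : ContDiff ℝ 2 φ)
    (hφc : HasCompactSupport φ) (i : Fin N) : ∃ C : ℝ, ∀ (t : ℝ) (x : 𝔼),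
      ‖(heatOp t φ - φ) x - (heatOp t φ - φ) (reflect i x)‖ ≤ C * √t * |x i| := by
  obtain ⟨L, h_lip⟩ := exists_norm_sub_sub_le hφ hφc
  have h_pos : ∀ z : 𝔼, 0 ≤ gaussProd (fun _ => 1) z := gaussProd_nonneg _
  refine ⟨2 * L * ∫ z : 𝔼, gaussProd (fun _ => 1) z * ‖z‖, fun t x => ?_⟩
  calc ‖(heatOp t φ - φ) x - (heatOp t φ - φ) (reflect i x)‖
      = ‖∫ z : 𝔼, gaussProd (fun _ => 1) z • (φ (x - √t • z) - φ x -
          (φ (reflect i x - √t • z) - φ (reflect i x)))‖ := by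
        simp only [smul_sub (_ : ℝ) (_ - _ : ℂ)]
        rw [heatOp_sub_self_apply, heatOp_sub_self_apply, integral_sub
          (integrable_gaussProd_smul_sub t φ x) (integrable_gaussProd_smul_sub t φ (reflect i x))]
    _ ≤ ∫ z : 𝔼, 2 * L * √t * |x i| * (gaussProd (fun _ => 1) z * ‖z‖) := by
        refine norm_integral_le_of_norm_le
          ((integrable_gaussProd_mul_norm fun _ => one_pos).const_mul _) (.of_forall fun z => ?_)
        have h := h_lip x (reflect i x) (√t • z)
        rw [norm_sub_reflect, norm_smul, Real.norm_of_nonneg (Real.sqrt_nonneg t)] at h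
        rw [norm_smul, Real.norm_of_nonneg (h_pos z)]
        exact (mul_le_mul_of_nonneg_left h (h_pos z)).trans_eq (by ring)
    _ = _ := by
        rw [integral_const_mul]
        ring

theorem inv_sqrt_eq_rpow {r : ℝ} (hr : 0 ≤ r) : (√r)⁻¹ = r ^ (-(1 / 2) : ℝ) := by
  rw [Real.rpow_neg hr, Real.sqrt_eq_rpow]

theorem intervalIntegrable_inv_sqrt_sub {t : ℝ} (ht : 0 ≤ t) :
    IntervalIntegrable (fun s => (√(t - s))⁻¹) volume 0 t := by
  have h : IntervalIntegrable (fun r => (√r)⁻¹) volume 0 t := by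
    refine (intervalIntegral.intervalIntegrable_rpow' (r := -(1 / 2)) (by norm_num)).congr ?_
    intro r hr
    rw [uIoc_of_le ht] at hr
    exact (inv_sqrt_eq_rpow hr.1.le).symm
  simpa using (h.comp_sub_left t).symm

theorem integral_inv_sqrt_sub {t : ℝ} (ht : 0 ≤ t) :
    ∫ s in (0 : ℝ)..t, (√(t - s))⁻¹ = 2 * √t := by
  rw [intervalIntegral.integral_comp_sub_left (fun r => (√r)⁻¹) t, sub_self, sub_zero]
  calc ∫ r in (0 : ℝ)..t, (√r)⁻¹ = ∫ r in (0 : ℝ)..t, r ^ (-(1 / 2) : ℝ) := by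
        refine intervalIntegral.integral_congr fun r hr => ?_
        rw [uIcc_of_le ht] at hr
        exact inv_sqrt_eq_rpow hr.1
    _ = 2 * √t := by
        rw [integral_rpow (Or.inl (by norm_num)), Real.sqrt_eq_rpow]
        norm_num [Real.zero_rpow]
        ring

theorem norm_integral_heatOp_sub_reflect_le (i : Fin N) {t M : ℝ} (ht : 0 ≤ t)
    {f : ℝ → C₀(𝔼, ℂ)} (hf : IntervalIntegrable (fun s => heatOp (t - s) (f s)) volume 0 t)
    (hM : ∀ s ∈ Icc 0 t, ‖f s‖ ≤ M) (x : 𝔼) :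
    ‖(∫ s in (0 : ℝ)..t, heatOp (t - s) (f s)) x -
        (∫ s in (0 : ℝ)..t, heatOp (t - s) (f s)) (reflect i x)‖ ≤ 8 * M * √t * |x i| := by
  calc _ = ‖∫ s in (0 : ℝ)..t, (evalCLM x - evalCLM (reflect i x)) (heatOp (t - s) (f s))‖ := by
        rw [ContinuousLinearMap.intervalIntegral_comp_comm _ hf]
        rfl
    _ ≤ ∫ s in (0 : ℝ)..t, 4 * |x i| * M * (√(t - s))⁻¹ := by
        refine intervalIntegral.norm_integral_le_of_norm_le ht ?_
          ((intervalIntegrable_inv_sqrt_sub ht).const_mul _)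
        filter_upwards [Measure.ae_ne volume t] with s hst hs
        refine (norm_heatOp_sub_reflect_le i (sub_pos.2 (hs.2.lt_of_ne hst)) (f s) x).trans ?_
        rw [mul_right_comm _ M]
        gcongr
        exact hM s (Ioc_subset_Icc_self hs)
    _ = 8 * M * √t * |x i| := by
        rw [intervalIntegral.integral_const_mul, integral_inv_sqrt_sub ht]
        ring

theorem IsSolution.exists_norm_sub_le (i : Fin N) {α : ℝ} (hα : 0 < α) {lam : ℂ} {φ : C₀(𝔼, ℂ)}
    {T : EReal} {u : ℝ → C₀(𝔼, ℂ)} (hu : IsSolution α lam φ T u) (hφ : oddReflect i φ = φ)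
    (hφs : ContDiff ℝ 2 φ) (hφc : HasCompactSupport φ) {b : ℝ} (hb : (b : EReal) < T) :
    ∃ C : ℝ, ∀ t ∈ Icc 0 b, ∀ x : 𝔼, ‖u t x - φ x‖ ≤ C * √t * |x i| := by
  have h_sub := Icc_subset_setOf_lt hb
  have h_cont : ContinuousOn u (Icc 0 b) := hu.continuousOn.mono h_sub
  have h_pair := isMildPair_heatOp (N := N) hα lam
  obtain ⟨C, h_linear⟩ := exists_norm_heatOp_sub_self_sub_reflect_le hφs hφc i
  obtain ⟨M, hM⟩ := isCompact_Icc.exists_bound_of_continuousOn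
    (h_pair.continuous.comp_continuousOn h_cont)
  refine ⟨(C + 8 * M) / 2, fun t ht x => ?_⟩
  let I := ∫ s in (0 : ℝ)..t, heatOp (t - s) (lam • powerC₀ α hα (u s))
  have h_duhamel : ∀ y, (u t - φ) y = (heatOp t φ - φ) y + I y := fun y => by
    rw [((isSolution_iff hα).1 hu).2 t ht.1 (h_sub ht).2]
    exact add_sub_right_comm (heatOp t φ y) (I y) (φ y)
  have h_odd : oddReflect i (u t - φ) = u t - φ := by
    rw [map_sub, hφ, hu.oddReflect_eq i hα hφ ht.1 (h_sub ht).2]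
  have h_integral : ‖I x - I (reflect i x)‖ ≤ 8 * M * √t * |x i| :=
    norm_integral_heatOp_sub_reflect_le i ht.1
      (h_pair.intervalIntegrable_integrand ht.1 (h_cont.mono (Icc_subset_Icc_right ht.2)))
      (fun s hs => hM s ⟨hs.1, hs.2.trans ht.2⟩) x
  have h_two : 2 * ‖u t x - φ x‖ ≤ C * √t * |x i| + 8 * M * √t * |x i| :=
    calc 2 * ‖u t x - φ x‖ = ‖(u t - φ) x - (u t - φ) (reflect i x)‖ :=
          two_mul_norm_eq_of_oddReflect h_odd x
      _ ≤ _ := by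
          rw [h_duhamel, h_duhamel, add_sub_add_comm]
          exact (norm_add_le _ _).trans (add_le_add (h_linear t x) h_integral)
  linarith

/-! ### The initial value -/

/-- A smooth even cutoff function on `ℝ`, equal to `1` on `[-1, 1]` and to `0` off `[-2, 2]`. -/
def cutoff : ContDiffBump (0 : ℝ) := ⟨1, 2, one_pos, one_lt_two⟩

theorem cutoff_eq_one {y : ℝ} (hy : |y| ≤ 1) : cutoff y = 1 :=
  cutoff.one_of_mem_closedBall (by simpa [cutoff] using hy)

theorem cutoff_eq_zero {y : ℝ} (hy : 2 ≤ |y|) : cutoff y = 0 :=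
  cutoff.zero_of_le_dist (by simpa [cutoff] using hy)

/-- The image `|ψ|^α ψ` of the cutoff function `ψ` under the nonlinearity. -/
def cutoffPow (α y : ℝ) : ℝ := cutoff y ^ α * cutoff y

theorem cutoffPow_nonneg (α y : ℝ) : 0 ≤ cutoffPow α y :=
  mul_nonneg (Real.rpow_nonneg cutoff.nonneg _) cutoff.nonneg

theorem cutoffPow_le_one {α : ℝ} (hα : 0 ≤ α) (y : ℝ) : cutoffPow α y ≤ 1 :=
  mul_le_one₀ (Real.rpow_le_one cutoff.nonneg cutoff.le_one hα) cutoff.nonneg cutoff.le_one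

theorem cutoffPow_eq_one {α y : ℝ} (hy : |y| ≤ 1) : cutoffPow α y = 1 := by
  rw [cutoffPow, cutoff_eq_one hy, Real.one_rpow, one_mul]

theorem continuous_cutoffPow {α : ℝ} (hα : 0 ≤ α) : Continuous (cutoffPow α) :=
  (cutoff.continuous.rpow_const fun _ => Or.inr hα).mul cutoff.continuous

theorem integrable_cutoffPow_mul_gauss {α a : ℝ} (hα : 0 ≤ α) (ha : 0 < a) :
    Integrable fun y => cutoffPow α y * gauss a y :=
  (integrable_gauss ha).mono'
    ((continuous_cutoffPow hα).mul (continuous_gauss a)).aestronglyMeasurable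
    (.of_forall fun y => by
      rw [Real.norm_of_nonneg (mul_nonneg (cutoffPow_nonneg _ _) (gauss_nonneg _ _))]
      exact mul_le_of_le_one_left (gauss_nonneg _ _) (cutoffPow_le_one hα y))

theorem integral_cutoffPow_mul_gauss_le_one {α a : ℝ} (hα : 0 ≤ α) (ha : 0 < a) :
    ∫ y, cutoffPow α y * gauss a y ≤ 1 := by
  rw [← integral_gauss ha]
  exact integral_mono (integrable_cutoffPow_mul_gauss hα ha) (integrable_gauss ha) fun y =>
    mul_le_of_le_one_left (gauss_nonneg _ _) (cutoffPow_le_one hα y)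

theorem le_gauss {a y : ℝ} (ha : a ∈ Icc (1 : ℝ) 2) (hy : |y| ≤ 1) :
    (√(4 * Real.pi * 2))⁻¹ * Real.exp (-1) ≤ gauss a y := by
  have ha₀ : 0 < a := one_pos.trans_le ha.1
  have h_exponent : y ^ 2 / (4 * a) ≤ 1 :=
    (div_le_one (by positivity)).2 (by linarith [(sq_le_one_iff_abs_le_one y).2 hy, ha.1])
  have h_width : 4 * Real.pi * a ≤ 4 * Real.pi * 2 :=
    mul_le_mul_of_nonneg_left ha.2 (by positivity)
  unfold gauss
  gcongr

theorem exists_le_integral_cutoffPow_mul_gauss {α : ℝ} (hα : 0 ≤ α) : ∃ κ : ℝ, 0 < κ ∧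
    κ ≤ 1 ∧ ∀ a ∈ Icc (1 : ℝ) 2, κ ≤ ∫ y, cutoffPow α y * gauss a y := by
  have h_le : ∀ a ∈ Icc (1 : ℝ) 2, 2 * ((√(4 * Real.pi * 2))⁻¹ * Real.exp (-1)) ≤
      ∫ y, cutoffPow α y * gauss a y := by
    intro a ha
    have h_int := integrable_cutoffPow_mul_gauss hα (one_pos.trans_le ha.1)
    calc 2 * ((√(4 * Real.pi * 2))⁻¹ * Real.exp (-1))
        = ∫ _ in Icc (-1 : ℝ) 1, (√(4 * Real.pi * 2))⁻¹ * Real.exp (-1) := by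
          rw [setIntegral_const, Measure.real, Real.volume_Icc, smul_eq_mul]
          norm_num
      _ ≤ ∫ y in Icc (-1 : ℝ) 1, cutoffPow α y * gauss a y := by
          refine setIntegral_mono_on continuousOn_const.integrableOn_Icc h_int.integrableOn
            measurableSet_Icc fun y hy => ?_
          rw [cutoffPow_eq_one (abs_le.2 hy), one_mul]
          exact le_gauss ha (abs_le.2 hy)
      _ ≤ _ := setIntegral_le_integral h_int
          (.of_forall fun y => mul_nonneg (cutoffPow_nonneg _ _) (gauss_nonneg _ _))
  exact ⟨_, by positivity, (h_le 1 ⟨le_rfl, one_le_two⟩).trans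
    (integral_cutoffPow_mul_gauss_le_one hα one_pos), h_le⟩

theorem continuous_abs_rpow_mul_self {α : ℝ} (hα : 0 ≤ α) : Continuous fun y : ℝ => |y| ^ α * y :=
  (continuous_abs.rpow_const fun _ => Or.inr hα).mul continuous_id

theorem norm_abs_rpow_mul_self_mul {α : ℝ} (hα : 0 ≤ α) (y r : ℝ) :
    ‖|y| ^ α * y * r‖ = |y| ^ (α + 1) * |r| := by
  rw [Real.rpow_add_one' (abs_nonneg y) (by linarith), norm_mul, norm_mul, Real.norm_eq_abs,
    Real.norm_eq_abs, Real.norm_eq_abs, abs_of_nonneg (by positivity : 0 ≤ |y| ^ α)]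

theorem integrable_abs_rpow_mul_fifthDerivGauss {α a : ℝ} (hα : 0 ≤ α) (ha : 0 < a) :
    Integrable fun y : ℝ => |y| ^ α * y * fifthDerivGauss a y := by
  obtain ⟨C, -, h⟩ := exists_abs_rpow_mul_fifthDerivGauss_le (by linarith : 0 ≤ α + 1)
  exact ((integrable_gauss (by positivity : 0 < 2 * a)).const_mul _).mono'
    ((continuous_abs_rpow_mul_self hα).mul (continuous_fifthDerivGauss a)).aestronglyMeasurable
    (.of_forall fun y => (norm_abs_rpow_mul_self_mul hα y _).trans_le (h a ha y))

theorem integrable_abs_rpow_mul_cutoffPow_mul_fifthDerivGauss {α a : ℝ} (hα : 0 ≤ α)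
    (ha : 0 < a) : Integrable fun y : ℝ => |y| ^ α * y * fifthDerivGauss a y * cutoffPow α y :=
  (integrable_abs_rpow_mul_fifthDerivGauss hα ha).mul_bdd (c := 1)
    (continuous_cutoffPow hα).aestronglyMeasurable (.of_forall fun y => by
      rw [Real.norm_of_nonneg (cutoffPow_nonneg _ _)]
      exact cutoffPow_le_one hα y)

-- Where the cutoff differs from `1` the Gaussian beats every power of `a`, so that the cutoff only
-- costs a constant.
theorem exists_abs_rpow_mul_fifthDerivGauss_sub_le_cutoffPow {α : ℝ} (hα₀ : 0 ≤ α) (hα₄ : α ≤ 4) :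
    ∃ C : ℝ, 0 ≤ C ∧ ∀ a : ℝ, 0 < a → ∀ y : ℝ,
      |y| ^ α * y * fifthDerivGauss a y - C * gauss (2 * a) y ≤
        |y| ^ α * y * fifthDerivGauss a y * cutoffPow α y := by
  obtain ⟨C, hC, h⟩ := exists_abs_rpow_mul_fifthDerivGauss_le (β := 5) (by norm_num)
  refine ⟨C, hC.le, fun a ha y => ?_⟩
  have h_gauss : 0 ≤ C * gauss (2 * a) y := mul_nonneg hC.le (gauss_nonneg _ _)
  rcases le_total |y| 1 with hy | hy
  · rw [cutoffPow_eq_one hy, mul_one]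
    exact sub_le_self _ h_gauss
  · have h_le : |y| ^ α * y * fifthDerivGauss a y ≤ C * gauss (2 * a) y :=
      calc |y| ^ α * y * fifthDerivGauss a y ≤ |y| ^ (α + 1) * |fifthDerivGauss a y| :=
            (Real.le_norm_self _).trans_eq (norm_abs_rpow_mul_self_mul hα₀ y _)
        _ ≤ |y| ^ (5 : ℝ) * |fifthDerivGauss a y| := by
            gcongr
            linarith
        _ ≤ C * gauss (2 * a) y := by
            simpa only [sub_self, Real.rpow_zero, mul_one] using h a ha y
    nlinarith [cutoffPow_nonneg α y, cutoffPow_le_one hα₀ y]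

theorem exists_le_integral_rpow_mul_fifthDerivGauss_mul_cutoffPow {α : ℝ} (hα₀ : 0 < α)
    (hα₂ : α < 2) :
    ∃ K C : ℝ, 0 < K ∧ 0 ≤ C ∧ ∀ a : ℝ, 0 < a → K * a ^ (α / 2 - 2) - C ≤
      ∫ y : ℝ, |y| ^ α * y * fifthDerivGauss a y * cutoffPow α y := by
  obtain ⟨C, hC, h⟩ :=
    exists_abs_rpow_mul_fifthDerivGauss_sub_le_cutoffPow hα₀.le (by linarith : α ≤ 4)
  refine ⟨_, C, integral_abs_rpow_mul_fifthDerivGauss_one_pos hα₀ hα₂, hC, fun a ha => ?_⟩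
  have h_int := integrable_abs_rpow_mul_fifthDerivGauss hα₀.le ha
  have h_gauss := (integrable_gauss (by positivity : 0 < 2 * a)).const_mul C
  calc _ = ∫ y : ℝ, (|y| ^ α * y * fifthDerivGauss a y - C * gauss (2 * a) y) := by
        rw [integral_sub h_int h_gauss, integral_const_mul, integral_gauss (by positivity),
          mul_one, integral_abs_rpow_mul_fifthDerivGauss α ha]
    _ ≤ _ := integral_mono (h_int.sub h_gauss)
        (integrable_abs_rpow_mul_cutoffPow_mul_fifthDerivGauss hα₀.le ha) (h a ha)

/-- The initial value `x ↦ x i * ∏ j, ψ (x j)`, with `ψ` the cutoff, as a real function. -/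
def oddBump (i : Fin N) (x : 𝔼) : ℝ := x i * ∏ j, cutoff (x j)

theorem contDiff_oddBump (i : Fin N) : ContDiff ℝ ∞ (oddBump i : 𝔼 → ℝ) := by
  have h_coord : ∀ j : Fin N, ContDiff ℝ ∞ fun x : 𝔼 => x j := fun j => by fun_prop
  exact (h_coord i).mul (contDiff_prod fun j _ => cutoff.contDiff.comp (h_coord j))

theorem hasCompactSupport_oddBump (i : Fin N) : HasCompactSupport (oddBump i : 𝔼 → ℝ) := by
  refine HasCompactSupport.intro (isCompact_closedBall (0 : 𝔼) (√(N * 2 ^ 2))) fun x hx => ?_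
  by_contra h_ne
  have h_coord : ∀ j, |x j| ≤ 2 := fun j => by
    by_contra! hj
    exact h_ne (mul_eq_zero_of_right _
      (Finset.prod_eq_zero (Finset.mem_univ j) (cutoff_eq_zero hj.le)))
  refine hx ?_
  rw [mem_closedBall_zero_iff, EuclideanSpace.norm_eq]
  refine Real.sqrt_le_sqrt ?_
  calc ∑ j, ‖x j‖ ^ 2 ≤ ∑ _ : Fin N, (2 : ℝ) ^ 2 := by
        gcongr with j
        exact h_coord j
    _ = _ := by simp

theorem abs_oddBump_le (i : Fin N) (x : 𝔼) : |oddBump i x| ≤ |x i| := by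
  rw [oddBump, abs_mul, abs_of_nonneg (Finset.prod_nonneg fun j _ => cutoff.nonneg)]
  exact mul_le_of_le_one_right (abs_nonneg _)
    (Finset.prod_le_one (fun j _ => cutoff.nonneg) fun j _ => cutoff.le_one)

/-- The initial value `x ↦ x i * ∏ j, ψ (x j)`, with `ψ` the cutoff. -/
def initialValue (i : Fin N) : C₀(𝔼, ℂ) where
  toFun x := (oddBump i x : ℂ)
  continuous_toFun := Complex.continuous_ofReal.comp (contDiff_oddBump i).continuous
  zero_at_infty' := ((hasCompactSupport_oddBump i).comp_left Complex.ofReal_zero).is_zero_at_infty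

theorem initialValue_apply (i : Fin N) (x : 𝔼) : initialValue i x = (oddBump i x : ℂ) := rfl

theorem norm_initialValue_apply_le (i : Fin N) (x : 𝔼) : ‖initialValue i x‖ ≤ |x i| := by
  rw [initialValue_apply, Complex.norm_real]
  exact abs_oddBump_le i x

theorem contDiff_initialValue (i : Fin N) : ContDiff ℝ ∞ (initialValue i : 𝔼 → ℂ) :=
  Complex.ofRealCLM.contDiff.comp (contDiff_oddBump i)

theorem hasCompactSupport_initialValue (i : Fin N) :
    HasCompactSupport (initialValue i : 𝔼 → ℂ) :=
  (hasCompactSupport_oddBump i).comp_left Complex.ofReal_zero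

theorem oddReflect_initialValue (i : Fin N) : oddReflect i (initialValue i) = initialValue i := by
  ext x
  have h_cutoff : ∏ j, cutoff (reflect i x j) = ∏ j, cutoff (x j) := by
    refine Finset.prod_congr rfl fun j _ => ?_
    rw [reflect_apply]
    split_ifs
    · exact cutoff.neg _
    · rfl
  rw [oddReflect_apply, initialValue_apply, initialValue_apply, oddBump, oddBump, h_cutoff,
    reflect_apply, if_pos rfl, neg_mul, Complex.ofReal_neg, neg_neg]

theorem powerNonlinearity_ofReal (α r : ℝ) :
    powerNonlinearity α (r : ℂ) = ((|r| ^ α * r : ℝ) : ℂ) := by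
  rw [powerNonlinearity, Complex.norm_real, Real.norm_eq_abs, ← Complex.ofReal_mul]

theorem abs_rpow_mul_oddBump (α : ℝ) (i : Fin N) (x : 𝔼) :
    |oddBump i x| ^ α * oddBump i x = |x i| ^ α * x i * ∏ j, cutoffPow α (x j) := by
  have h_nonneg : 0 ≤ ∏ j, cutoff (x j) := Finset.prod_nonneg fun j _ => cutoff.nonneg
  simp only [cutoffPow]
  rw [Finset.prod_mul_distrib, Real.finsetProd_rpow _ _ fun j _ => cutoff.nonneg, oddBump,
    abs_mul, abs_of_nonneg h_nonneg, Real.mul_rpow (abs_nonneg _) h_nonneg]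
  ring

theorem integral_testFun_mul_abs_rpow_mul_oddBump (α : ℝ) (i : Fin N) (c : Fin N → ℝ) :
    ∫ x : 𝔼, testFun i c x * (|oddBump i x| ^ α * oddBump i x) =
      (∫ y, |y| ^ α * y * fifthDerivGauss (c i) y * cutoffPow α y) *
        ∏ j ∈ Finset.univ.erase i, ∫ y, cutoffPow α y * gauss (c j) y := by
  rw [← integral_mul_prod_erase]
  refine integral_congr_ae (.of_forall fun x => ?_)
  dsimp only
  rw [abs_rpow_mul_oddBump, testFun, Finset.prod_mul_distrib,
    ← Finset.mul_prod_erase _ (fun j => cutoffPow α (x j)) (Finset.mem_univ i)]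
  ring

theorem exists_le_integral_testFun_mul_abs_rpow_mul_oddBump {α : ℝ} (hα₀ : 0 < α) (hα₂ : α < 2) :
    ∃ K C : ℝ, 0 < K ∧ ∀ (i : Fin N) (c : Fin N → ℝ), 0 < c i →
      (∀ j, j ≠ i → c j ∈ Icc (1 : ℝ) 2) → K * c i ^ (α / 2 - 2) - C ≤
        ∫ x : 𝔼, testFun i c x * (|oddBump i x| ^ α * oddBump i x) := by
  obtain ⟨K, C, hK, hC, h_moment⟩ :=
    exists_le_integral_rpow_mul_fifthDerivGauss_mul_cutoffPow hα₀ hα₂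
  obtain ⟨κ, hκ, hκ_le_one, h_cutoff⟩ := exists_le_integral_cutoffPow_mul_gauss hα₀.le
  refine ⟨K * κ ^ N, C, by positivity, fun i c hi hc => ?_⟩
  rw [integral_testFun_mul_abs_rpow_mul_oddBump]
  set P := ∏ j ∈ Finset.univ.erase i, ∫ y, cutoffPow α y * gauss (c j) y
  have h_factor : ∀ j ∈ Finset.univ.erase i, κ ≤ ∫ y, cutoffPow α y * gauss (c j) y :=
    fun j hj => h_cutoff _ (hc j (Finset.ne_of_mem_erase hj))
  have hP_le_one : P ≤ 1 := Finset.prod_le_one (fun j hj => hκ.le.trans (h_factor j hj))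
    fun j hj => integral_cutoffPow_mul_gauss_le_one hα₀.le
      (one_pos.trans_le (hc j (Finset.ne_of_mem_erase hj)).1)
  have hP_ge : κ ^ N ≤ P :=
    calc κ ^ N ≤ κ ^ (Finset.univ.erase i).card :=
          pow_le_pow_of_le_one hκ.le hκ_le_one (by simp)
      _ = ∏ _j ∈ Finset.univ.erase i, κ := by rw [Finset.prod_const]
      _ ≤ P := Finset.prod_le_prod (fun _ _ => hκ.le) h_factor
  have hP : 0 ≤ P := (by positivity : 0 ≤ κ ^ N).trans hP_ge
  calc K * κ ^ N * c i ^ (α / 2 - 2) - C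
      = K * c i ^ (α / 2 - 2) * κ ^ N - C * 1 := by ring
    _ ≤ K * c i ^ (α / 2 - 2) * P - C * P := by gcongr
    _ = (K * c i ^ (α / 2 - 2) - C) * P := by ring
    _ ≤ _ := by
        gcongr
        exact h_moment (c i) hi

theorem norm_powerC₀_apply_sub_initialValue_le {α : ℝ} (hα : 0 < α) {i : Fin N} {η : ℝ}
    (hη : η ≤ 1) {v : C₀(𝔼, ℂ)} {x : 𝔼} (hv : ‖v x - initialValue i x‖ ≤ η * |x i|) :
    ‖powerC₀ α hα v x - powerC₀ α hα (initialValue i) x‖ ≤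
      (2 + α) * 2 ^ α * η * |x i| ^ (α + 1) := by
  have h_init := norm_initialValue_apply_le i x
  have h_v : ‖v x‖ ≤ 2 * |x i| := by
    have h_triangle := norm_le_norm_add_norm_sub' (v x) (initialValue i x)
    nlinarith [abs_nonneg (x i)]
  calc ‖powerC₀ α hα v x - powerC₀ α hα (initialValue i) x‖
      ≤ (2 + α) * (2 * |x i|) ^ α * ‖v x - initialValue i x‖ :=
        norm_powerNonlinearity_sub_le hα.le h_v (by linarith [abs_nonneg (x i)])
    _ ≤ (2 + α) * (2 * |x i|) ^ α * (η * |x i|) := by gcongr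
    _ = (2 + α) * 2 ^ α * η * |x i| ^ (α + 1) := by
        rw [Real.mul_rpow two_pos.le (abs_nonneg _),
          Real.rpow_add_one' (abs_nonneg _) (by linarith)]
        ring

theorem integral_testFun_smul_powerC₀_initialValue {α : ℝ} (hα : 0 < α) (i : Fin N)
    (c : Fin N → ℝ) : ∫ x, testFun i c x • powerC₀ α hα (initialValue i) x =
      ((∫ x : 𝔼, testFun i c x * (|oddBump i x| ^ α * oddBump i x) : ℝ) : ℂ) := by
  simp only [← integral_complex_ofReal, powerC₀_apply, initialValue_apply,
    powerNonlinearity_ofReal, Complex.real_smul, ← Complex.ofReal_mul]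

theorem exists_norm_integral_testFun_smul_powerC₀_sub_le {α : ℝ} (hα : 0 < α) :
    ∃ D : ℝ, 0 < D ∧ ∀ (i : Fin N) (v : C₀(𝔼, ℂ)) (η : ℝ), 0 ≤ η → η ≤ 1 →
      (∀ x, ‖v x - initialValue i x‖ ≤ η * |x i|) → ∀ c : Fin N → ℝ, (∀ j, 0 < c j) →
        ‖(∫ x, testFun i c x • powerC₀ α hα v x) -
          ∫ x, testFun i c x • powerC₀ α hα (initialValue i) x‖ ≤ η * D * c i ^ (α / 2 - 2) := by
  have hα₁ : 0 ≤ α + 1 := by linarith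
  obtain ⟨D, hD, h_moment⟩ := exists_integral_abs_rpow_mul_testFun_le (N := N) hα₁
  refine ⟨(2 + α) * 2 ^ α * D, by positivity, fun i v η hη₀ hη hv c hc => ?_⟩
  have h_int := integrable_testFun i hc
  calc _ = ‖∫ x, testFun i c x • (powerC₀ α hα v x - powerC₀ α hα (initialValue i) x)‖ := by
        simp only [smul_sub]
        rw [integral_sub (integrable_smul_apply h_int _) (integrable_smul_apply h_int _)]
    _ ≤ ∫ x : 𝔼, (2 + α) * 2 ^ α * η * (|x i| ^ (α + 1) * |testFun i c x|) := by
        refine norm_integral_le_of_norm_le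
          ((integrable_abs_rpow_mul_testFun hα₁ i hc).const_mul _) (.of_forall fun x => ?_)
        rw [norm_smul, Real.norm_eq_abs, mul_comm, ← mul_assoc]
        gcongr
        exact norm_powerC₀_apply_sub_initialValue_le hα hη (hv x)
    _ ≤ (2 + α) * 2 ^ α * η * (D * c i ^ ((α + 1) / 2 - 5 / 2)) := by
        rw [integral_const_mul]
        gcongr
        exact h_moment i c hc
    _ = η * ((2 + α) * 2 ^ α * D) * c i ^ (α / 2 - 2) := by ring_nf

theorem exists_le_re_integral_testFun_smul_powerC₀ {α : ℝ} (hα₀ : 0 < α) (hα₂ : α < 2) :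
    ∃ η κ C : ℝ, 0 < η ∧ 0 < κ ∧ ∀ (i : Fin N) (v : C₀(𝔼, ℂ)),
      (∀ x, ‖v x - initialValue i x‖ ≤ η * |x i|) → ∀ c : Fin N → ℝ, 0 < c i →
        (∀ j, j ≠ i → c j ∈ Icc (1 : ℝ) 2) →
          κ * c i ^ (α / 2 - 2) - C ≤ (∫ x, testFun i c x • powerC₀ α hα₀ v x).re := by
  obtain ⟨K, C, hK, h_init⟩ :=
    exists_le_integral_testFun_mul_abs_rpow_mul_oddBump (N := N) hα₀ hα₂
  obtain ⟨D, hD, h_diff⟩ := exists_norm_integral_testFun_smul_powerC₀_sub_le (N := N) hα₀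
  let η := min 1 (K / (2 * D))
  have hη : 0 < η := by positivity
  refine ⟨η, K / 2, C, hη, half_pos hK, fun i v hv c hi hc => ?_⟩
  have hηD : η * D ≤ K / 2 :=
    calc η * D ≤ K / (2 * D) * D := by
          gcongr
          exact min_le_right _ _
      _ = K / 2 := by field_simp
  have h_pos := pos_of_pos_of_one_le hi fun j hj => (hc j hj).1
  have h_le := (Complex.abs_re_le_norm _).trans (h_diff i v η hη.le (min_le_left _ _) hv c h_pos)
  rw [integral_testFun_smul_powerC₀_initialValue, Complex.sub_re, Complex.ofReal_re] at h_le
  have h_rpow : 0 ≤ c i ^ (α / 2 - 2) := by positivity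
  nlinarith [neg_le_of_abs_le h_le, h_init i c hi hc]

/-! ### Loss of regularity -/

theorem IsSolution.exists_forall_norm_sub_le (i : Fin N) {α : ℝ} (hα : 0 < α) {lam : ℂ}
    {φ : C₀(𝔼, ℂ)} {T : EReal} {u : ℝ → C₀(𝔼, ℂ)} (hu : IsSolution α lam φ T u)
    (hφ : oddReflect i φ = φ) (hφs : ContDiff ℝ 2 φ) (hφc : HasCompactSupport φ) (hT : 0 < T)
    {η : ℝ} (hη : 0 < η) :
    ∃ δ : ℝ, 0 < δ ∧ (δ : EReal) < T ∧ ∀ t ∈ Icc 0 δ, ∀ x : 𝔼, ‖u t x - φ x‖ ≤ η * |x i| := by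
  obtain ⟨b, hb, hbT⟩ := EReal.lt_iff_exists_real_btwn.1 hT
  obtain ⟨C, hC⟩ := hu.exists_norm_sub_le i hα hφ hφs hφc hbT
  have h_tendsto : Tendsto (fun t : ℝ => C * √t) (𝓝 0) (𝓝 0) := by
    have h_cont : Continuous fun t : ℝ => C * √t := by fun_prop
    simpa only [Real.sqrt_zero, mul_zero] using h_cont.tendsto 0
  obtain ⟨ε, hε, hε'⟩ := Metric.eventually_nhds_iff_ball.1 (h_tendsto.eventually_le_const hη)
  refine ⟨min b (ε / 2), lt_min (EReal.coe_pos.1 hb) (half_pos hε),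
    (EReal.coe_le_coe_iff.2 (min_le_left _ _)).trans_lt hbT, fun t ht x => ?_⟩
  have ht_ball : t ∈ Metric.ball 0 ε := by
    rw [mem_ball_zero_iff, Real.norm_of_nonneg ht.1]
    exact (ht.2.trans (min_le_right _ _)).trans_lt (half_lt_self hε)
  exact (hC t ⟨ht.1, ht.2.trans (min_le_left _ _)⟩ x).trans
    (mul_le_mul_of_nonneg_right (hε' t ht_ball) (abs_nonneg _))

theorem IsSolution.intervalIntegrable_integral_testFun_smul (i : Fin N) {c : Fin N → ℝ}
    (hc : ∀ j, 0 < c j) {α : ℝ} (hα : 0 < α) {lam : ℂ} {φ : C₀(𝔼, ℂ)} {T : EReal}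
    {u : ℝ → C₀(𝔼, ℂ)} (hu : IsSolution α lam φ T u) {t : ℝ} (ht : 0 ≤ t) (hT : (t : EReal) < T) :
    IntervalIntegrable (fun s => ∫ x, testFun i (fun j => c j + (t - s)) x • powerC₀ α hα (u s) x)
      volume 0 t := by
  have h_int := (isMildPair_heatOp hα 1).intervalIntegrable_integrand ht
    (hu.continuousOn.mono (Icc_subset_setOf_lt hT))
  let ℓ := pairCLM (testFun i c) (integrable_testFun i hc)
  have h_pair : IntervalIntegrable
      (fun s => ℓ (heatOp (t - s) ((1 : ℂ) • powerC₀ α hα (u s)))) volume 0 t :=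
    ⟨ℓ.integrable_comp h_int.1, ℓ.integrable_comp h_int.2⟩
  refine h_pair.congr fun s hs => ?_
  rw [uIoc_of_le ht] at hs
  simp only [one_smul]
  exact integral_testFun_smul_heatOp i hc (sub_nonneg.2 hs.2) _

theorem IsSolution.integral_testFun_smul_eq (i : Fin N) {c : Fin N → ℝ} (hc : ∀ j, 0 < c j)
    {α : ℝ} (hα : 0 < α) {lam : ℂ} {φ : C₀(𝔼, ℂ)} {T : EReal} {u : ℝ → C₀(𝔼, ℂ)}
    (hu : IsSolution α lam φ T u) {t : ℝ} (ht : 0 ≤ t) (hT : (t : EReal) < T) :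
    ∫ x, testFun i c x • u t x = (∫ x, testFun i (fun j => c j + t) x • φ x) +
      lam * ∫ s in (0 : ℝ)..t,
        ∫ x, testFun i (fun j => c j + (t - s)) x • powerC₀ α hα (u s) x := by
  have h_int := (isMildPair_heatOp hα lam).intervalIntegrable_integrand ht
    (hu.continuousOn.mono (Icc_subset_setOf_lt hT))
  rw [← pairCLM_apply (integrable_testFun i hc), ((isSolution_iff hα).1 hu).2 t ht hT, mildMap,
    map_add, ← ContinuousLinearMap.intervalIntegral_comp_comm _ h_int,
    ← intervalIntegral.integral_const_mul]
  refine congrArg₂ _ (integral_testFun_smul_heatOp i hc ht φ)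
    (intervalIntegral.integral_congr fun s hs => ?_)
  rw [uIcc_of_le ht] at hs
  simp only [pairCLM_apply, integral_testFun_smul_heatOp i hc (sub_nonneg.2 hs.2),
    ZeroAtInftyContinuousMap.smul_apply, smul_eq_mul, ← mul_smul_comm, integral_const_mul]

theorem IsSolution.norm_integral_integral_testFun_smul_le (i : Fin N) {c : Fin N → ℝ}
    (hc : ∀ j, 0 < c j) {α : ℝ} (hα : 0 < α) {lam : ℂ} (hlam : lam ≠ 0) {φ : C₀(𝔼, ℂ)} {T : EReal}
    {u : ℝ → C₀(𝔼, ℂ)} (hu : IsSolution α lam φ T u) {t : ℝ} (ht : 0 ≤ t) (hT : (t : EReal) < T) :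
    ‖∫ s in (0 : ℝ)..t, ∫ x, testFun i (fun j => c j + (t - s)) x • powerC₀ α hα (u s) x‖ ≤
      ‖lam‖⁻¹ * (‖∫ x, testFun i c x • u t x‖ + ‖∫ x, testFun i (fun j => c j + t) x • φ x‖) := by
  rw [le_inv_mul_iff₀ (norm_pos_iff.2 hlam), ← norm_mul,
    ← sub_eq_of_eq_add' (hu.integral_testFun_smul_eq i hc hα ht hT)]
  exact norm_sub_le _ _

theorem exists_norm_integral_testFun_smul_le : ∃ D : ℝ, 0 < D ∧
    ∀ (i : Fin N) (c : Fin N → ℝ), 0 < c i → (∀ j, j ≠ i → 1 ≤ c j) →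
      ∀ f : 𝔼 → ℂ, Integrable f →
        ‖∫ x, testFun i c x • f x‖ ≤ D * c i ^ (-3 : ℝ) * ∫ x, ‖f x‖ := by
  obtain ⟨D, hD, h⟩ := exists_abs_testFun_le (N := N)
  refine ⟨D, hD, fun i c hi hc f hf => ?_⟩
  rw [← integral_const_mul]
  refine norm_integral_le_of_norm_le (hf.norm.const_mul _) (.of_forall fun x => ?_)
  rw [norm_smul, Real.norm_eq_abs]
  gcongr
  exact h i c hi hc x

theorem intervalIntegrable_rpow_add_sub (β : ℝ) {a t : ℝ} (ha : 0 < a) (ht : 0 ≤ t) :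
    IntervalIntegrable (fun s => (a + (t - s)) ^ β) volume 0 t := by
  refine ContinuousOn.intervalIntegrable (.rpow_const (by fun_prop) fun s hs => Or.inl ?_)
  rw [uIcc_of_le ht] at hs
  linarith [hs.2]

theorem le_integral_rpow_add_sub {β a t : ℝ} (hβ : β < -1) (ha : 0 < a) (ht : 0 < t) :
    (a ^ (β + 1) - t ^ (β + 1)) / -(β + 1) ≤ ∫ s in (0 : ℝ)..t, (a + (t - s)) ^ β := by
  have h_zero : (0 : ℝ) ∉ uIcc a (a + t) := by
    rw [uIcc_of_le (by linarith)]
    exact fun h => ha.not_ge h.1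
  have h_le : (a + t) ^ (β + 1) ≤ t ^ (β + 1) :=
    Real.rpow_le_rpow_of_nonpos ht (by linarith) (by linarith)
  calc (a ^ (β + 1) - t ^ (β + 1)) / -(β + 1)
      = (t ^ (β + 1) - a ^ (β + 1)) / (β + 1) := by rw [div_neg, ← neg_div, neg_sub]
    _ ≤ ((a + t) ^ (β + 1) - a ^ (β + 1)) / (β + 1) :=
        div_le_div_of_nonpos_of_le (by linarith) (by linarith)
    _ = ∫ r in a..a + t, r ^ β := (integral_rpow (Or.inr ⟨hβ.ne, h_zero⟩)).symm
    _ = ∫ s in (0 : ℝ)..t, (a + (t - s)) ^ β := by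
        simp only [← add_sub_assoc,
          intervalIntegral.integral_comp_sub_left (fun r : ℝ => r ^ β), add_sub_cancel_right,
          sub_zero]

theorem le_re_integral_of_rpow_add_sub_le {β κ C a t : ℝ} (hβ : β < -1) (hκ : 0 ≤ κ) (ha : 0 < a)
    (ht : 0 < t) {J : ℝ → ℂ} (hJ : IntervalIntegrable J volume 0 t)
    (h : ∀ s ∈ Icc 0 t, κ * (a + (t - s)) ^ β - C ≤ (J s).re) :
    κ * ((a ^ (β + 1) - t ^ (β + 1)) / -(β + 1)) - C * t ≤ (∫ s in (0 : ℝ)..t, J s).re := by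
  have h_rpow := (intervalIntegrable_rpow_add_sub β ha ht.le).const_mul κ
  calc _ ≤ κ * (∫ s in (0 : ℝ)..t, (a + (t - s)) ^ β) - C * t := by
        gcongr
        exact le_integral_rpow_add_sub hβ ha ht
    _ = ∫ s in (0 : ℝ)..t, (κ * (a + (t - s)) ^ β - C) := by
        rw [intervalIntegral.integral_sub h_rpow intervalIntegrable_const,
          intervalIntegral.integral_const_mul, intervalIntegral.integral_const, sub_zero,
          smul_eq_mul, mul_comm C]
    _ ≤ ∫ s in (0 : ℝ)..t, (J s).re :=
        intervalIntegral.integral_mono_on ht.le (h_rpow.sub intervalIntegrable_const)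
          ⟨Complex.reCLM.integrable_comp hJ.1, Complex.reCLM.integrable_comp hJ.2⟩ h
    _ = _ := Complex.reCLM.intervalIntegral_comp_comm hJ

theorem IsSolution.rpow_sub_le_norm_integral_testFun_smul (i : Fin N) {c : Fin N → ℝ}
    (hi : 0 < c i) {α : ℝ} (hα₀ : 0 < α) (hα₂ : α < 2) {lam : ℂ} (hlam : lam ≠ 0) {κ C : ℝ}
    (hκ : 0 ≤ κ) {φ : C₀(𝔼, ℂ)} {T : EReal} {u : ℝ → C₀(𝔼, ℂ)} (hu : IsSolution α lam φ T u)
    {t : ℝ} (ht : 0 < t) (hT : (t : EReal) < T) (hc : ∀ j, j ≠ i → 1 ≤ c j ∧ c j + t ≤ 2)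
    (h : ∀ r ∈ Icc 0 t, ∀ c : Fin N → ℝ, 0 < c i → (∀ j, j ≠ i → c j ∈ Icc (1 : ℝ) 2) →
      κ * c i ^ (α / 2 - 2) - C ≤ (∫ x, testFun i c x • powerC₀ α hα₀ (u r) x).re) :
    κ * ((c i ^ (α / 2 - 2 + 1) - t ^ (α / 2 - 2 + 1)) / -(α / 2 - 2 + 1)) - C * t ≤
      ‖lam‖⁻¹ * (‖∫ x, testFun i c x • u t x‖ + ‖∫ x, testFun i (fun j => c j + t) x • φ x‖) := by
  have h_pos := pos_of_pos_of_one_le hi fun j hj => (hc j hj).1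
  refine (le_re_integral_of_rpow_add_sub_le (by linarith) hκ hi ht
    (hu.intervalIntegrable_integral_testFun_smul i h_pos hα₀ ht.le hT) fun r hr => ?_).trans
    ((Complex.re_le_norm _).trans
      (hu.norm_integral_integral_testFun_smul_le i h_pos hα₀ hlam ht.le hT))
  exact h r hr (fun j => c j + (t - r)) (by linarith [hr.2]) fun j hj =>
    ⟨by linarith [hr.2, (hc j hj).1], by linarith [hr.1, (hc j hj).2]⟩

theorem IsSolution.not_memHsp (i : Fin N) {α : ℝ} (hα₀ : 0 < α) (hα₂ : α < 2) {lam : ℂ}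
    (hlam : lam ≠ 0) {κ C : ℝ} (hκ : 0 < κ) {φ : C₀(𝔼, ℂ)} (hφ : Integrable φ) {T : EReal}
    {u : ℝ → C₀(𝔼, ℂ)} (hu : IsSolution α lam φ T u) {t : ℝ} (ht : 0 < t) (ht₁ : t ≤ 1)
    (hT : (t : EReal) < T) (h : ∀ r ∈ Icc 0 t, ∀ c : Fin N → ℝ, 0 < c i →
      (∀ j, j ≠ i → c j ∈ Icc (1 : ℝ) 2) →
        κ * c i ^ (α / 2 - 2) - C ≤ (∫ x, testFun i c x • powerC₀ α hα₀ (u r) x).re)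
    {p : ℝ≥0∞} [Fact (1 ≤ p)] (hp : 1 < p) (hp' : p < ⊤) {s : ℝ} (hs : 5 + 1 / p.toReal < s) :
    ¬ MemHsp s p (u t) := by
  intro hv
  obtain ⟨B, hB⟩ := exists_norm_integral_testFun_le_of_memHsp hp hp' hs hv i
  obtain ⟨D, hD, h_init⟩ := exists_norm_integral_testFun_smul_le (N := N)
  let R := ‖lam‖⁻¹ * (B + D * t ^ (-3 : ℝ) * ∫ x, ‖φ x‖)
  have h_bound : ∀ a : ℝ, 0 < a →
      κ * ((a ^ (α / 2 - 2 + 1) - t ^ (α / 2 - 2 + 1)) / -(α / 2 - 2 + 1)) - C * t ≤ R := by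
    intro a ha
    let c : Fin N → ℝ := Function.update (fun _ => 1) i a
    have hci : c i = a := Function.update_self ..
    have hcj : ∀ j, j ≠ i → c j = 1 := fun j hj => Function.update_of_ne hj ..
    have hi : 0 < c i := hci ▸ ha
    have h_data : ‖∫ x, testFun i (fun j => c j + t) x • φ x‖ ≤
        D * t ^ (-3 : ℝ) * ∫ x, ‖φ x‖ := by
      refine (h_init i (fun j => c j + t) (by linarith)
        (fun j hj => by linarith [hcj j hj]) φ hφ).trans ?_
      have h_rpow : (c i + t) ^ (-3 : ℝ) ≤ t ^ (-3 : ℝ) :=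
        Real.rpow_le_rpow_of_nonpos ht (by linarith) (by norm_num)
      gcongr
    calc _ ≤ ‖lam‖⁻¹ * (‖∫ x, testFun i c x • u t x‖ +
            ‖∫ x, testFun i (fun j => c j + t) x • φ x‖) := by
          simpa only [hci] using hu.rpow_sub_le_norm_integral_testFun_smul i hi hα₀ hα₂ hlam hκ.le
            ht hT (fun j hj => by rw [hcj j hj]; exact ⟨le_rfl, by linarith⟩) h
      _ ≤ ‖lam‖⁻¹ * (B + D * t ^ (-3 : ℝ) * ∫ x, ‖φ x‖) := by
          gcongr
          exact hB c hi fun j hj => (hcj j hj).ge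
  have h_tendsto : Tendsto (fun a : ℝ =>
      κ * ((a ^ (α / 2 - 2 + 1) - t ^ (α / 2 - 2 + 1)) / -(α / 2 - 2 + 1)) - C * t)
      (𝓝[>] 0) atTop :=
    tendsto_atTop_add_const_right _ _ <| .const_mul_atTop hκ <| .atTop_div_const (by linarith) <|
      tendsto_atTop_add_const_right _ _ (tendsto_rpow_neg_nhdsGT_zero (by linarith))
  obtain ⟨a, ha_gt, ha⟩ :=
    ((h_tendsto.eventually_gt_atTop R).and self_mem_nhdsWithin).exists
  exact ha_gt.not_ge (h_bound a ha)

end SemilinearHeat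

end

theorem theorem1p4 (N : ℕ) (hN : 1 ≤ N) (α : ℝ) (hα₀ : 0 < α) (hα₂ : α < 2)
    (lam : ℂ) (hlam : lam ≠ 0) :
    ∃ φ : EuclideanSpace ℝ (Fin N) → ℂ, ContDiff ℝ ∞ φ ∧ HasCompactSupport φ ∧
      ∃ (T : EReal) (u : ℝ → C₀(EuclideanSpace ℝ (Fin N), ℂ)),
        SemilinearHeat.IsMaximalSolution α lam φ T u ∧
        ∃ δ : ℝ, 0 < δ ∧ (δ : EReal) ≤ T ∧
          ∀ t : ℝ, 0 < t → t < δ →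
            ∀ (p : ℝ≥0∞) [Fact (1 ≤ p)], 1 < p → p < ⊤ →
              ∀ s : ℝ, 5 + 1 / p.toReal < s → ¬ SemilinearHeat.MemHsp s p (u t) := by
  let i : Fin N := ⟨0, hN⟩
  let φ := SemilinearHeat.initialValue i
  have hφ : ContDiff ℝ ∞ φ := SemilinearHeat.contDiff_initialValue i
  have hφc : HasCompactSupport φ := SemilinearHeat.hasCompactSupport_initialValue i
  obtain ⟨T, u, hu⟩ := SemilinearHeat.exists_isMaximalSolution hα₀ lam φ
  obtain ⟨η, κ, C, hη, hκ, h_lower⟩ :=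
    SemilinearHeat.exists_le_re_integral_testFun_smul_powerC₀ (N := N) hα₀ hα₂
  obtain ⟨δ, hδ, hδT, h_near⟩ := hu.isSolution.exists_forall_norm_sub_le i hα₀
    (SemilinearHeat.oddReflect_initialValue i) (contDiff_infty.1 hφ 2) hφc hu.pos hη
  refine ⟨φ, hφ, hφc, T, u, hu, min δ 1, lt_min hδ one_pos,
    (EReal.coe_le_coe_iff.2 (min_le_left _ _)).trans hδT.le, fun t ht htδ p _ hp hp' s hs => ?_⟩
  obtain ⟨htδ, ht₁⟩ := lt_min_iff.1 htδ
  exact hu.isSolution.not_memHsp i hα₀ hα₂ hlam hκ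
    (φ.continuous.integrable_of_hasCompactSupport hφc) ht ht₁.le
    ((EReal.coe_lt_coe_iff.2 htδ).trans hδT)
    (fun r hr c => h_lower i (u r) (h_near r ⟨hr.1, hr.2.trans htδ.le⟩) c) hp hp' hs
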